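/- Let $\beta_0,\beta_1,\beta_\infty\in(-1,0]$, $|\pmb\beta|=\beta_0+\beta_1+\beta_\infty$, and let $m_{\pmb\beta}=e^{2\phi}|dz|^2$ be the unit area metric of constant Gaussian curvature $2\pi(|\pmb\beta|+2)$ on $\overline{\mathbb C}_z=\mathbb C\cup\{\infty\}$ with conical singularities of orders $\beta_0,\beta_1,\beta_\infty$ at $0,1,\infty$. That is, $\phi$ is real-valued and smooth on $\mathbb C\setminus\{0,1\}$, $e^{-2\phi}(-4\partial_z\partial_{\bar z}\phi)=2\pi(|\pmb\beta|+2)$ there, $\int_{\mathbb C}e^{2\phi}=1$ (Lebesgue measure), and for some constants $\phi_0,\phi_1,\phi_\infty$ one has $\phi(z)=\beta_0\log|z|+\phi_0+o(1)$ as $z\to0$, $\phi(z)=\beta_1\log|z-1|+\phi_1+o(1)$ as $z\to1$, $\phi(z)=-(\beta_\infty+2)\log|z|+\phi_\infty+o(1)$ as $z\to\infty$. Put $\mathfrak s_j=-\beta_j(2+\beta_j)$ for $j\in\{0,1,\infty\}$ and $$\mathfrak h_0=-\mathfrak h_1=\tfrac12(\mathfrak s_0+\mathfrak s_1-\mathfrak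 s_\infty),\qquad \mathfrak h_\infty=\tfrac12(\mathfrak s_1+\mathfrak s_\infty-\mathfrak s_0).$$ For a real potential $\varphi$ write $T_\varphi=2(\partial_x^2\varphi-(\partial_x\varphi)^2)$, where $\partial_x$ is the Wirtinger derivative in the complex variable $x$. Let $f:\overline{\mathbb C}_x\to\overline{\mathbb C}_z$ be a nonconstant rational function that is unramified outside of $f^{-1}(\{0,1,\infty\})$ and satisfies $f(\infty)\in\{0,1,\infty\}$. Let $x_1,\dots,x_n$ be the preimages of $0,1,\infty$ under $f$, let $\operatorname{ord}_kf+1\ge1$ be the local multiplicity of $f$ at $x_k$, and let $$(f^*\pmb\beta)_k=(\operatorname{ord}_kf+1)(\beta_{f(x_k)}+1)-1,\qquad s_k=-(f^*\pmb\beta)_k\bigl((f^*\pmb\beta)_k+2\bigr).$$ Let $f^*\phi=\phi\circ f+\log|f'|$ be the potential of the pullback metric $f^*m_{\pmb\beta}=e^{2f^*\phi}|dx|^2$. Then $n=\deg f+2$, and there are numbers $h_k\in\mathbb C$, $k=1,\dots,n$, such that $$T_{f^*\phi}(x)=\sum_{k:\,x_k\ne\infty}\left(\frac{s_k}{2(x-x_k)^2}+\frac{h_k}{x-x_k}\right),\qquad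 x\in\mathbb C\setminus\{x_1,\dots,x_n\},$$ $$T_{f^*\phi}(x)=\frac{s_k}{2x^2}+\frac{h_k}{x^3}+O(x^{-4}),\qquad x\to x_k=\infty,$$ and the accessory parameters $h_k$ are given as follows. 1. If $x_k$ is not a pole of $f$, then $$h_k=\begin{cases}\dfrac{d_k}{c_k}\,\mathfrak s_{f(x_k)}+c_k\,\mathfrak h_{f(x_k)},&\operatorname{ord}_kf=0,\\[2mm] -\dfrac{d_k}{c_k}\,\dfrac{(f^*\pmb\beta)_k((f^*\pmb\beta)_k+2)}{\operatorname{ord}_kf+1},&\operatorname{ord}_kf>0,\end{cases}$$ where $c_k\ne0$ and $d_k$ are the coefficients in the expansion $$f(x)-f(x_k)=c_kx^{-\operatorname{ord}_kf-1}\left(1+\frac{d_k}{c_k}\frac1x+O(x^{-2})\right)\quad\text{as }x\to x_k,\text{ if }x_k=\infty,$$ $$f(x)-f(x_k)=c_k(x-x_k)^{\operatorname{ord}_kf+1}\left(1+\frac{d_k}{c_k}(x-x_k)+O((x-x_k)^2)\right)\quad\text{as }x\to x_k,\text{ if }x_k\ne\infty.$$ 2. If $x_k$ is a pole of $f$, then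 $$h_k=\begin{cases}-\dfrac{d_k}{c_k}\,\mathfrak s_\infty+\dfrac1{c_k}\,\mathfrak h_\infty,&\operatorname{ord}_kf=0,\\[2mm] \dfrac{d_k}{c_k}\,\dfrac{(f^*\pmb\beta)_k((f^*\pmb\beta)_k+2)}{\operatorname{ord}_kf+1},&\operatorname{ord}_kf>0,\end{cases}$$ where $c_k\ne0$ and $d_k$ are the coefficients in the expansion $$f(x)=c_kx^{\operatorname{ord}_kf+1}\left(1+\frac{d_k}{c_k}\frac1x+O(x^{-2})\right)\quad\text{as }x\to x_k,\text{ if }x_k=\infty,$$ $$f(x)=c_k(x-x_k)^{-\operatorname{ord}_kf-1}\left(1+\frac{d_k}{c_k}(x-x_k)+O((x-x_k)^2)\right)\quad\text{as }x\to x_k,\text{ if }x_k\ne\infty.$$ -/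

import Mathlib

open Filter Topology Asymptotics Polynomial OnePoint

noncomputable section

namespace ConicalSphere

/-! ### Wirtinger derivatives and the stress-energy tensor -/

/-- The Wirtinger derivative `∂_z g = (∂_x g - i ∂_y g) / 2` of a function `g` of `z = x + i y`. -/
def dz (g : ℂ → ℂ) (z : ℂ) : ℂ :=
  (fderiv ℝ g z 1 - Complex.I * fderiv ℝ g z Complex.I) / 2

/-- The Wirtinger derivative `∂_{z̄} g = (∂_x g + i ∂_y g) / 2`. -/
def dzbar (g : ℂ → ℂ) (z : ℂ) : ℂ :=
  (fderiv ℝ g z 1 + Complex.I * fderiv ℝ g z Complex.I) / 2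

/-- The classical stress-energy tensor `T_φ = 2 (∂_z² φ - (∂_z φ)²)` of a real potential `φ`. -/
def stressEnergy (φ : ℂ → ℝ) (z : ℂ) : ℂ :=
  2 * (dz (dz fun w => (φ w : ℂ)) z - (dz (fun w => (φ w : ℂ)) z) ^ 2)

/-! ### The constant curvature metric with three conical singularities -/

/-- The divisor `β₀ · 0 + β₁ · 1 + β_∞ · ∞` on the Riemann sphere. -/
structure TriDivisor where
  /-- the order at `0` -/
  b0 : ℝ
  /-- the order at `1` -/
  b1 : ℝ
  /-- the order at `∞` -/
  binf : ℝ

/-- The degree `|β| = β₀ + β₁ + β_∞`. -/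
def TriDivisor.degree (β : TriDivisor) : ℝ := β.b0 + β.b1 + β.binf

open Classical in
/-- The coefficient `β_p` of the divisor at the point `p` of the Riemann sphere. -/
def TriDivisor.at (β : TriDivisor) (p : OnePoint ℂ) : ℝ :=
  if p = ((0 : ℂ) : OnePoint ℂ) then β.b0
  else if p = ((1 : ℂ) : OnePoint ℂ) then β.b1
  else if p = ∞ then β.binf
  else 0

/-- The weight `𝔰_p = -β_p (2 + β_p)`. -/
def TriDivisor.weight (β : TriDivisor) (p : OnePoint ℂ) : ℝ := -β.at p * (2 + β.at p)

open Classical in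
/-- Schwarz's accessory parameters of the three-point metric:
`𝔥₀ = -𝔥₁ = (𝔰₀ + 𝔰₁ - 𝔰_∞) / 2` and `𝔥_∞ = (𝔰₁ + 𝔰_∞ - 𝔰₀) / 2`
(by convention `0` at the other points). -/
def TriDivisor.schwarzParam (β : TriDivisor) (p : OnePoint ℂ) : ℝ :=
  let s0 := β.weight ((0 : ℂ) : OnePoint ℂ)
  let s1 := β.weight ((1 : ℂ) : OnePoint ℂ)
  let sinf := β.weight ∞
  if p = ((0 : ℂ) : OnePoint ℂ) then (s0 + s1 - sinf) / 2
  else if p = ((1 : ℂ) : OnePoint ℂ) then -((s0 + s1 - sinf) / 2)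
  else if p = ∞ then (s1 + sinf - s0) / 2
  else 0

/-- `φ` is the potential of the unit area constant curvature metric `m_β = e^{2φ} |dz|²` on the
Riemann sphere that represents the divisor `β`: `φ` is smooth on `ℂ ∖ {0, 1}`, solves there the
Liouville equation with Gaussian curvature `2π(|β| + 2)`, and has conical singularities of orders
`β₀`, `β₁`, `β_∞` at `0`, `1`, `∞`. -/
structure IsTriPotential (β : TriDivisor) (φ : ℂ → ℝ) : Prop where
  smooth : ContDiffOn ℝ (⊤ : ℕ∞) φ {0, 1}ᶜ
  liouville : ∀ z : ℂ, z ≠ 0 → z ≠ 1 →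
    (Real.exp (-2 * φ z) : ℂ) * (-4 * dz (dzbar fun w => (φ w : ℂ)) z)
      = ((2 * Real.pi * (β.degree + 2) : ℝ) : ℂ)
  asymp_zero : ∃ φ0 : ℝ,
    Tendsto (fun z => φ z - β.b0 * Real.log ‖z‖) (𝓝[≠] (0 : ℂ)) (𝓝 φ0)
  asymp_one : ∃ φ1 : ℝ,
    Tendsto (fun z => φ z - β.b1 * Real.log ‖z - 1‖) (𝓝[≠] (1 : ℂ)) (𝓝 φ1)
  asymp_infty : ∃ φinf : ℝ,
    Tendsto (fun z => φ z + (β.binf + 2) * Real.log ‖z‖) (Bornology.cobounded ℂ) (𝓝 φinf)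
  area : ∫ z : ℂ, Real.exp (2 * φ z) = 1

/-! ### Rational functions as maps of the Riemann sphere -/

/-- The rational function `f` as a function on `ℂ` (meaningful off the poles). -/
def ratFun (f : RatFunc ℂ) (x : ℂ) : ℂ := f.eval (RingHom.id ℂ) x

/-- The map of the Riemann sphere `ℂ ∪ {∞}` to itself given by a rational function. -/
def sphereMap (f : RatFunc ℂ) : OnePoint ℂ → OnePoint ℂ
  | ∞ =>
    if f.denom.natDegree < f.num.natDegree then ∞
    else ((f.num.coeff f.denom.natDegree / f.denom.leadingCoeff : ℂ) : OnePoint ℂ)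
  | (a : ℂ) => if f.denom.eval a = 0 then ∞ else ((ratFun f a : ℂ) : OnePoint ℂ)

/-- The degree `max (deg P) (deg Q)` of `f = P / Q` with coprime `P`, `Q`. -/
def ratDegree (f : RatFunc ℂ) : ℕ := max f.num.natDegree f.denom.natDegree

/-- The local multiplicity of a nonconstant rational function `f = P / Q` at a point of the Riemann
sphere: the multiplicity of the pole, or the order of vanishing of
`f - v = (P - v Q) / Q` where `v` is the finite value of `f` at the point
(the order in `1 / x` if the point is `∞`). -/
def mult (f : RatFunc ℂ) (p : OnePoint ℂ) : ℕ :=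
  match p, sphereMap f p with
  | ∞, ∞ => f.num.natDegree - f.denom.natDegree
  | ∞, (v : ℂ) => f.denom.natDegree - (f.num - C v * f.denom).natDegree
  | (a : ℂ), ∞ => f.denom.rootMultiplicity a
  | (a : ℂ), (v : ℂ) => (f.num - C v * f.denom).rootMultiplicity a

/-- The ramification order of `f` at `p` (the local multiplicity is at least `1` for
nonconstant `f`). -/
def ramOrd (f : RatFunc ℂ) (p : OnePoint ℂ) : ℕ := mult f p - 1

/-- The set `{0, 1, ∞}` on the Riemann sphere. -/
def threePoints : Set (OnePoint ℂ) := {((0 : ℂ) : OnePoint ℂ), ((1 : ℂ) : OnePoint ℂ), ∞}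

/-- The preimages `x_k` of the points `0`, `1`, `∞` under `f`. -/
def marked (f : RatFunc ℂ) : Set (OnePoint ℂ) := sphereMap f ⁻¹' threePoints

/-- `f` is a Belyi function on the Riemann sphere: a nonconstant rational function, unramified
outside of the preimages of `{0, 1, ∞}`. -/
def IsBelyi (f : RatFunc ℂ) : Prop :=
  1 ≤ ratDegree f ∧ ∀ p : OnePoint ℂ, sphereMap f p ∉ threePoints → ramOrd f p = 0

/-- `c` and `d` are the first two coefficients of the Taylor or Laurent expansion of `f` at `p`.
With `N = ramOrd f p + 1`:
`f(x) = c x^N (1 + (d/c) / x + O(x⁻²))` if `p = ∞` is a pole,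
`f(x) - v = c x^{-N} (1 + (d/c) / x + O(x⁻²))` if `p = ∞` and `f(∞) = v ≠ ∞`,
`f(x) = c (x - a)^{-N} (1 + (d/c) (x - a) + O((x - a)²))` if `p = a ≠ ∞` is a pole,
`f(x) - v = c (x - a)^N (1 + (d/c) (x - a) + O((x - a)²))` if `p = a ≠ ∞` and `f(a) = v ≠ ∞`. -/
def HasCoeffs (f : RatFunc ℂ) (p : OnePoint ℂ) (c d : ℂ) : Prop :=
  let N : ℤ := (ramOrd f p : ℤ) + 1
  c ≠ 0 ∧
  match p, sphereMap f p with
  | ∞, ∞ =>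
    (fun x : ℂ => ratFun f x - c * x ^ N * (1 + d / c * x⁻¹))
      =O[Bornology.cobounded ℂ] fun x : ℂ => x ^ (N - 2)
  | ∞, (v : ℂ) =>
    (fun x : ℂ => ratFun f x - v - c * x ^ (-N) * (1 + d / c * x⁻¹))
      =O[Bornology.cobounded ℂ] fun x : ℂ => x ^ (-N - 2)
  | (a : ℂ), ∞ =>
    (fun x : ℂ => ratFun f x - c * (x - a) ^ (-N) * (1 + d / c * (x - a)))
      =O[𝓝[≠] a] fun x : ℂ => (x - a) ^ (-N + 2)
  | (a : ℂ), (v : ℂ) =>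
    (fun x : ℂ => ratFun f x - v - c * (x - a) ^ N * (1 + d / c * (x - a)))
      =O[𝓝[≠] a] fun x : ℂ => (x - a) ^ (N + 2)

/-! ### The pullback metric -/

/-- The potential `f^*φ = φ ∘ f + log |f'|` of the pullback metric
`f^* m_β = e^{2 f^*φ} |dx|²`. -/
def pullPotential (f : RatFunc ℂ) (φ : ℂ → ℝ) (x : ℂ) : ℝ :=
  φ (ratFun f x) + Real.log ‖deriv (ratFun f) x‖

/-- The order `(f^*β)_p = (ord_p f + 1) (β_{f(p)} + 1) - 1` of the pullback metric at `p`. -/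
def pullOrder (f : RatFunc ℂ) (β : TriDivisor) (p : OnePoint ℂ) : ℝ :=
  ((ramOrd f p : ℝ) + 1) * (β.at (sphereMap f p) + 1) - 1

/-- The weight `s_p = -(f^*β)_p ((f^*β)_p + 2)` of the pullback metric at `p`. -/
def pullWeight (f : RatFunc ℂ) (β : TriDivisor) (p : OnePoint ℂ) : ℝ :=
  -pullOrder f β p * (pullOrder f β p + 2)

end ConicalSphere

end

open ConicalSphere

/-!
Write `T_φ` for the stress-energy tensor. Liouville's equation for `φ` says precisely that `T_φ` is
holomorphic off `0` and `1`. At a conical point `a` of order `γ`, subtract `γ log |z - a|` from `φ`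
and rescale: the remainder is uniformly small on discs of radius comparable to `|z - a|`, and an
interior estimate for small perturbations gives `(z - a)² T_φ(z) → -γ (γ + 2) / 2`. The same holds
at infinity. So `T_φ` is a rational function with double poles at `0` and `1`, and its behaviour at
infinity leaves no freedom for the two residues: they are Schwarz's accessory parameters.

The stress-energy tensor is pulled back like a projective connection, `T_{f^*φ} = (T_φ ∘ f) f'² +
S(f)` with `S(f)` the Schwarzian derivative. In local coordinates where
`f = c tᴺ (1 + (d / c) t + ⋯)`, this turns a double pole of `T_φ` at `f = 0` into a double pole at
`t = 0`, with a residue that depends only on `c` and `d`. Inversion of either coordinate preserves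
the form of the pullback, so poles of `f` and the point `∞` need no separate computation. As `f` is
unramified elsewhere, `T_{f^*φ}` has no other singularities, and Liouville's theorem makes it the
sum of its principal parts. The number of marked points is the Riemann–Hurwitz formula, which for a
rational function `P / Q` counts the zeros of the Wronskian `P Q' - P' Q`.
-/

noncomputable section

namespace ConicalSphere

open MeasureTheory
open scoped ComplexConjugate

/-! ### Wirtinger calculus -/

section Wirtinger

variable {f g : ℂ → ℂ} {z : ℂ}

lemma fderiv_apply_eq_dz_dzbar (g : ℂ → ℂ) (z v : ℂ) :
    fderiv ℝ g z v = dz g z * v + dzbar g z * conj v := by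
  have hv : v = v.re • (1 : ℂ) + v.im • Complex.I := by simp
  have hconj : conj v = v.re - v.im * Complex.I := by apply Complex.ext <;> simp
  have hlin : fderiv ℝ g z v = v.re * fderiv ℝ g z 1 + v.im * fderiv ℝ g z Complex.I := by
    conv_lhs =>
      rw [hv, map_add, _root_.map_smul, _root_.map_smul, Complex.real_smul, Complex.real_smul]
  rw [hlin, dz, dzbar, hconj]
  linear_combination (v.im * fderiv ℝ g z Complex.I) * Complex.I_sq +
    (fderiv ℝ g z 1 - Complex.I * fderiv ℝ g z Complex.I) / 2 * Complex.re_add_im v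

lemma dz_eq_of_fderiv_apply {a b : ℂ} (h : ∀ v, fderiv ℝ g z v = a * v + b * conj v) :
    dz g z = a := by
  rw [dz, h, h, map_one, Complex.conj_I]
  linear_combination (b - a) / 2 * Complex.I_sq

lemma dzbar_eq_of_fderiv_apply {a b : ℂ} (h : ∀ v, fderiv ℝ g z v = a * v + b * conj v) :
    dzbar g z = b := by
  rw [dzbar, h, h, map_one, Complex.conj_I]
  linear_combination (a - b) / 2 * Complex.I_sq

lemma dz_congr (h : f =ᶠ[𝓝 z] g) : dz f z = dz g z := by
  simp only [dz, h.fderiv_eq]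

lemma dzbar_congr (h : f =ᶠ[𝓝 z] g) : dzbar f z = dzbar g z := by
  simp only [dzbar, h.fderiv_eq]

lemma dz_const (c : ℂ) : dz (fun _ => c) z = 0 := by simp [dz]

lemma dzbar_const (c : ℂ) : dzbar (fun _ => c) z = 0 := by simp [dzbar]

lemma dz_add (hf : DifferentiableAt ℝ f z) (hg : DifferentiableAt ℝ g z) :
    dz (fun w => f w + g w) z = dz f z + dz g z := by
  simp only [dz, fderiv_fun_add hf hg, add_apply]; ring

lemma dzbar_add (hf : DifferentiableAt ℝ f z) (hg : DifferentiableAt ℝ g z) :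
    dzbar (fun w => f w + g w) z = dzbar f z + dzbar g z := by
  simp only [dzbar, fderiv_fun_add hf hg, add_apply]; ring

lemma dzbar_sub (hf : DifferentiableAt ℝ f z) (hg : DifferentiableAt ℝ g z) :
    dzbar (fun w => f w - g w) z = dzbar f z - dzbar g z := by
  simp only [dzbar, fderiv_fun_sub hf hg, sub_apply]; ring

lemma dz_mul (hf : DifferentiableAt ℝ f z) (hg : DifferentiableAt ℝ g z) :
    dz (fun w => f w * g w) z = dz f z * g z + f z * dz g z := by
  simp only [dz, fderiv_fun_mul hf hg, add_apply, smul_apply, smul_eq_mul]; ring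

lemma dzbar_mul (hf : DifferentiableAt ℝ f z) (hg : DifferentiableAt ℝ g z) :
    dzbar (fun w => f w * g w) z = dzbar f z * g z + f z * dzbar g z := by
  simp only [dzbar, fderiv_fun_mul hf hg, add_apply, smul_apply, smul_eq_mul]; ring

lemma dz_const_mul (c : ℂ) (hf : DifferentiableAt ℝ f z) :
    dz (fun w => c * f w) z = c * dz f z := by
  rw [dz_mul (by fun_prop) hf, dz_const]; ring

lemma dzbar_const_mul (c : ℂ) (hf : DifferentiableAt ℝ f z) :
    dzbar (fun w => c * f w) z = c * dzbar f z := by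
  rw [dzbar_mul (by fun_prop) hf, dzbar_const]; ring

lemma fderiv_real_apply (hf : DifferentiableAt ℂ f z) (v : ℂ) :
    fderiv ℝ f z v = deriv f z * v := by
  rw [hf.hasDerivAt.complexToReal_fderiv.fderiv]; simp

lemma dz_of_differentiableAt (hf : DifferentiableAt ℂ f z) : dz f z = deriv f z :=
  dz_eq_of_fderiv_apply (b := 0) fun v => by rw [fderiv_real_apply hf, zero_mul, add_zero]

lemma dzbar_of_differentiableAt (hf : DifferentiableAt ℂ f z) : dzbar f z = 0 :=
  dzbar_eq_of_fderiv_apply (a := deriv f z) fun v => by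
    rw [fderiv_real_apply hf, zero_mul, add_zero]

lemma differentiableAt_of_dzbar_eq_zero (hf : DifferentiableAt ℝ f z) (h : dzbar f z = 0) :
    DifferentiableAt ℂ f z := by
  refine differentiableAt_complex_iff_differentiableAt_real.2 ⟨hf, ?_⟩
  simp [fderiv_apply_eq_dz_dzbar, h, mul_comm]

lemma fderiv_comp_holomorphic_apply (hg : DifferentiableAt ℝ g (f z))
    (hf : DifferentiableAt ℂ f z) (v : ℂ) :
    fderiv ℝ (fun w => g (f w)) z v =
      dz g (f z) * deriv f z * v + dzbar g (f z) * conj (deriv f z) * conj v := by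
  rw [fderiv_fun_comp z hg hf.real_of_complex, ContinuousLinearMap.comp_apply,
    fderiv_real_apply hf, fderiv_apply_eq_dz_dzbar, map_mul]
  ring

lemma dz_comp_holomorphic (hg : DifferentiableAt ℝ g (f z)) (hf : DifferentiableAt ℂ f z) :
    dz (fun w => g (f w)) z = dz g (f z) * deriv f z :=
  dz_eq_of_fderiv_apply (fderiv_comp_holomorphic_apply hg hf)

lemma dzbar_comp_holomorphic (hg : DifferentiableAt ℝ g (f z)) (hf : DifferentiableAt ℂ f z) :
    dzbar (fun w => g (f w)) z = dzbar g (f z) * conj (deriv f z) :=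
  dzbar_eq_of_fderiv_apply (fderiv_comp_holomorphic_apply hg hf)

lemma dz_holomorphic_comp (hg : DifferentiableAt ℂ g (f z)) (hf : DifferentiableAt ℝ f z) :
    dz (fun w => g (f w)) z = deriv g (f z) * dz f z :=
  dz_eq_of_fderiv_apply (b := deriv g (f z) * dzbar f z) fun v => by
    rw [fderiv_fun_comp z hg.real_of_complex hf, ContinuousLinearMap.comp_apply,
      fderiv_real_apply hg, fderiv_apply_eq_dz_dzbar]
    ring

lemma dzbar_ofReal_eq_conj_dz {φ : ℂ → ℝ} (hφ : DifferentiableAt ℝ (fun w => (φ w : ℂ)) z) :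
    dzbar (fun w => (φ w : ℂ)) z = conj (dz (fun w => (φ w : ℂ)) z) := by
  have hreal (v : ℂ) : conj (fderiv ℝ (fun w => (φ w : ℂ)) z v) =
      fderiv ℝ (fun w => (φ w : ℂ)) z v := by
    have h := (Complex.conjCLE.toContinuousLinearMap.hasFDerivAt.comp z hφ.hasFDerivAt).fderiv
    have hcomp : (⇑Complex.conjCLE.toContinuousLinearMap ∘ fun w => (φ w : ℂ)) =
        fun w => (φ w : ℂ) := by ext w; simp
    rw [hcomp] at h
    simpa using congrArg (· v) h.symm
  simp [dz, dzbar, hreal, Complex.conj_ofNat]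

lemma contDiffAt_dz {n m : WithTop ℕ∞} (hf : ContDiffAt ℝ n f z) (h : m + 1 ≤ n) :
    ContDiffAt ℝ m (dz f) z := by
  have := hf.fderiv_right h
  unfold dz
  fun_prop

lemma contDiffAt_dzbar {n m : WithTop ℕ∞} (hf : ContDiffAt ℝ n f z) (h : m + 1 ≤ n) :
    ContDiffAt ℝ m (dzbar f) z := by
  have := hf.fderiv_right h
  unfold dzbar
  fun_prop

lemma contDiffOn_dz {n m : WithTop ℕ∞} {U : Set ℂ} (hf : ContDiffOn ℝ n f U) (hU : IsOpen U)
    (h : m + 1 ≤ n) : ContDiffOn ℝ m (dz f) U := fun _ hw =>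
  (contDiffAt_dz (hf.contDiffAt (hU.mem_nhds hw)) h).contDiffWithinAt

lemma contDiffOn_dzbar {n m : WithTop ℕ∞} {U : Set ℂ} (hf : ContDiffOn ℝ n f U) (hU : IsOpen U)
    (h : m + 1 ≤ n) : ContDiffOn ℝ m (dzbar f) U := fun _ hw =>
  (contDiffAt_dzbar (hf.contDiffAt (hU.mem_nhds hw)) h).contDiffWithinAt

lemma fderiv_fderiv_apply (hf : DifferentiableAt ℝ (fderiv ℝ f) z) (v w : ℂ) :
    fderiv ℝ (fun x => fderiv ℝ f x v) z w = fderiv ℝ (fderiv ℝ f) z w v := by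
  rw [fderiv_clm_apply hf (by fun_prop)]; simp

lemma dz_dzbar_comm (hf : ContDiffAt ℝ 2 f z) : dz (dzbar f) z = dzbar (dz f) z := by
  have hsymm : IsSymmSndFDerivAt ℝ f z := hf.isSymmSndFDerivAt (by simp)
  have hd : DifferentiableAt ℝ (fderiv ℝ f) z :=
    (hf.fderiv_right (m := 1) (by norm_num)).differentiableAt (by norm_num)
  have hdz (w : ℂ) : fderiv ℝ (dz f) z w = (fderiv ℝ (fderiv ℝ f) z w 1 -
      Complex.I * fderiv ℝ (fderiv ℝ f) z w Complex.I) / 2 := by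
    unfold dz
    simp only [div_eq_mul_inv]
    rw [fderiv_mul_const (by fun_prop), fderiv_fun_sub (by fun_prop) (by fun_prop),
      fderiv_const_mul (by fun_prop)]
    simp only [smul_apply, sub_apply, fderiv_fderiv_apply hd, smul_eq_mul]
    ring
  have hdzbar (w : ℂ) : fderiv ℝ (dzbar f) z w = (fderiv ℝ (fderiv ℝ f) z w 1 +
      Complex.I * fderiv ℝ (fderiv ℝ f) z w Complex.I) / 2 := by
    unfold dzbar
    simp only [div_eq_mul_inv]
    rw [fderiv_mul_const (by fun_prop), fderiv_fun_add (by fun_prop) (by fun_prop),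
      fderiv_const_mul (by fun_prop)]
    simp only [smul_add, add_apply, smul_apply, fderiv_fderiv_apply hd, smul_eq_mul]
    ring
  rw [dz, dzbar, hdz, hdz, hdzbar, hdzbar, hsymm.eq Complex.I 1]
  ring

lemma contDiffAt_ofReal {φ : ℂ → ℝ} {n : WithTop ℕ∞} (hφ : ContDiffAt ℝ n φ z) :
    ContDiffAt ℝ n (fun w => (φ w : ℂ)) z :=
  Complex.ofRealCLM.contDiff.contDiffAt.comp z hφ

lemma contDiffAt_log_norm {n : WithTop ℕ∞} (hz : z ≠ 0) :
    ContDiffAt ℝ n (fun w => ((Real.log ‖w‖ : ℝ) : ℂ)) z :=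
  contDiffAt_ofReal ((contDiffAt_norm ℝ hz).log (norm_ne_zero_iff.2 hz))

lemma dz_log_norm (hz : z ≠ 0) : dz (fun w => ((Real.log ‖w‖ : ℝ) : ℂ)) z = 1 / (2 * z) := by
  have hsq : HasFDerivAt (fun w : ℂ => ‖w‖ ^ 2) (2 • innerSL ℝ z) z :=
    (hasStrictFDerivAt_norm_sq z).hasFDerivAt
  have hlog := Complex.ofRealCLM.hasFDerivAt.comp z
    ((hsq.log (pow_ne_zero 2 (norm_ne_zero_iff.2 hz))).const_mul (1 / 2 : ℝ))
  have hhalf : (fun w : ℂ => ((Real.log ‖w‖ : ℝ) : ℂ)) =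
      Complex.ofRealCLM ∘ fun w : ℂ => 1 / 2 * Real.log (‖w‖ ^ 2) := by
    ext w; simp [Real.log_pow]
  have hfderiv (v : ℂ) : fderiv ℝ (fun w => ((Real.log ‖w‖ : ℝ) : ℂ)) z v =
      ((v * conj z).re : ℂ) / (‖z‖ : ℂ) ^ 2 := by
    rw [hhalf, hlog.fderiv]
    simp only [one_div, ContinuousLinearMap.comp_smulₛₗ, map_inv₀, Real.ringHom_apply,
      ContinuousLinearMap.comp_smul, nsmul_eq_mul, Nat.cast_ofNat, smul_apply, mul_apply_eq_comp,
      ContinuousLinearMap.comp_apply, coe_innerSL_apply, Complex.inner, Complex.ofRealCLM_apply,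
      ContinuousLinearMap.ofNat_apply, Complex.real_smul, Complex.ofReal_inv, Complex.ofReal_pow,
      Complex.ofReal_ofNat]
    field_simp
  have hnorm : (‖z‖ : ℂ) ^ 2 = z * conj z := by
    rw [Complex.mul_conj, Complex.normSq_eq_norm_sq, Complex.ofReal_pow]
  have hconj : conj z ≠ 0 := by simpa using hz
  refine dz_eq_of_fderiv_apply (b := 1 / (2 * conj z)) fun v => ?_
  rw [hfderiv, hnorm, Complex.re_eq_add_conj, map_mul, Complex.conj_conj]
  field_simp

lemma dz_log_norm_comp (hf : DifferentiableAt ℂ f z) (hz : f z ≠ 0) :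
    dz (fun w => ((Real.log ‖f w‖ : ℝ) : ℂ)) z = logDeriv f z / 2 := by
  have hlog : DifferentiableAt ℝ (fun w : ℂ => ((Real.log ‖w‖ : ℝ) : ℂ)) (f z) :=
    (contDiffAt_log_norm (n := 1) hz).differentiableAt (by simp)
  rw [dz_comp_holomorphic hlog hf, dz_log_norm hz, logDeriv_apply]
  field_simp

end Wirtinger

/-! ### The transformation law of the stress-energy tensor -/

/-- The Schwarzian derivative `(f''/f')' - (f''/f')² / 2`. -/
def schwarzian (f : ℂ → ℂ) (x : ℂ) : ℂ :=
  deriv (logDeriv (deriv f)) x - logDeriv (deriv f) x ^ 2 / 2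

/-- The pullback `(τ ∘ f) f'² + S(f)` of a projective connection `τ` under a holomorphic map `f`,
with `S` the Schwarzian derivative; stress-energy tensors are pulled back in this way. -/
def pullTensor (τ f : ℂ → ℂ) (x : ℂ) : ℂ := τ (f x) * deriv f x ^ 2 + schwarzian f x

lemma analyticAt_logDeriv {f : ℂ → ℂ} {x : ℂ} (hf : AnalyticAt ℂ f x) (h : f x ≠ 0) :
    AnalyticAt ℂ (logDeriv f) x :=
  hf.deriv.div hf h

lemma dz_pull {φ : ℂ → ℝ} {f : ℂ → ℂ} {x : ℂ}
    (hφ : DifferentiableAt ℝ (fun w => (φ w : ℂ)) (f x)) (hf : AnalyticAt ℂ f x)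
    (hf' : deriv f x ≠ 0) :
    dz (fun w => ((φ (f w) + Real.log ‖deriv f w‖ : ℝ) : ℂ)) x =
      dz (fun w => (φ w : ℂ)) (f x) * deriv f x + 1 / 2 * logDeriv (deriv f) x := by
  have hlog : DifferentiableAt ℝ (fun w => ((Real.log ‖deriv f w‖ : ℝ) : ℂ)) x :=
    ((contDiffAt_log_norm (n := 1) hf').differentiableAt (by simp)).fun_comp' x
      hf.deriv.differentiableAt.real_of_complex
  simp only [Complex.ofReal_add]
  rw [dz_add (hφ.fun_comp' x hf.differentiableAt.real_of_complex) hlog,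
    dz_comp_holomorphic hφ hf.differentiableAt, dz_log_norm_comp hf.deriv.differentiableAt hf']
  ring

theorem stressEnergy_pull {φ : ℂ → ℝ} {f : ℂ → ℂ} {x : ℂ}
    (hφ : ContDiffAt ℝ 2 (fun w => (φ w : ℂ)) (f x)) (hf : AnalyticAt ℂ f x)
    (hf' : deriv f x ≠ 0) :
    stressEnergy (fun w => φ (f w) + Real.log ‖deriv f w‖) x =
      pullTensor (stressEnergy φ) f x := by
  have hdz : dz (fun w => ((φ (f w) + Real.log ‖deriv f w‖ : ℝ) : ℂ)) =ᶠ[𝓝 x]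
      fun w => dz (fun w => (φ w : ℂ)) (f w) * deriv f w + 1 / 2 * logDeriv (deriv f) w := by
    filter_upwards [hf.continuousAt.eventually (hφ.eventually (by simp)),
      hf.eventually_analyticAt, hf.deriv.continuousAt.eventually_ne hf'] with w hφw hfw hfw'
    exact dz_pull (hφw.differentiableAt (by simp)) hfw hfw'
  have hdzφ : DifferentiableAt ℝ (dz fun w => (φ w : ℂ)) (f x) :=
    (contDiffAt_dz hφ (m := 1) (by norm_num)).differentiableAt (by simp)
  have hdzφf := hdzφ.fun_comp' x hf.differentiableAt.real_of_complex
  have hderiv := hf.deriv.differentiableAt.real_of_complex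
  have hlogDeriv := (analyticAt_logDeriv hf.deriv hf').differentiableAt
  have hderiv₂ : deriv (deriv f) x = logDeriv (deriv f) x * deriv f x := by
    rw [logDeriv_apply, div_mul_cancel₀ _ hf']
  rw [stressEnergy, dz_congr hdz, hdz.self_of_nhds,
    dz_add (hdzφf.fun_mul hderiv) (hlogDeriv.real_of_complex.const_mul _), dz_mul hdzφf hderiv,
    dz_const_mul _ hlogDeriv.real_of_complex, dz_of_differentiableAt hlogDeriv,
    dz_of_differentiableAt hf.deriv.differentiableAt,
    dz_comp_holomorphic hdzφ hf.differentiableAt, pullTensor, stressEnergy, schwarzian, hderiv₂]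
  ring

theorem differentiableAt_stressEnergy_of_liouville {φ : ℂ → ℝ} {z κ : ℂ}
    (hφ : ContDiffAt ℝ 3 (fun w => (φ w : ℂ)) z)
    (h : ∀ᶠ w in 𝓝 z, dz (dzbar fun w => (φ w : ℂ)) w = κ * Complex.exp (2 * φ w)) :
    DifferentiableAt ℂ (stressEnergy φ) z := by
  set Φ : ℂ → ℂ := fun w => (φ w : ℂ)
  have hdz : ContDiffAt ℝ 2 (dz Φ) z := contDiffAt_dz hφ (by norm_num)
  have hΦd : DifferentiableAt ℝ Φ z := hφ.differentiableAt (by simp)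
  have hd : DifferentiableAt ℝ (dz Φ) z := hdz.differentiableAt (by simp)
  have hdd : DifferentiableAt ℝ (dz (dz Φ)) z :=
    (contDiffAt_dz (m := 1) hdz (by norm_num)).differentiableAt (by simp)
  have hdzbar_dz : dzbar (dz Φ) =ᶠ[𝓝 z] fun w => κ * Complex.exp (2 * Φ w) := by
    filter_upwards [h, hφ.eventually (by simp)] with w hw hφw
    rw [← hw, dz_dzbar_comm (hφw.of_le (by norm_num))]
  have hexp : HasDerivAt (fun w => κ * Complex.exp (2 * w))
      (κ * (Complex.exp (2 * Φ z) * (2 * 1))) (Φ z) :=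
    (((hasDerivAt_id (Φ z)).const_mul 2).cexp).const_mul κ
  have hdzbar_dz_dz : dzbar (dz (dz Φ)) z = κ * Complex.exp (2 * Φ z) * (2 * dz Φ z) := by
    rw [← dz_dzbar_comm hdz, dz_congr hdzbar_dz,
      dz_holomorphic_comp (g := fun w => κ * Complex.exp (2 * w)) (by fun_prop) hΦd, hexp.deriv]
    ring
  have hT : stressEnergy φ = fun w => 2 * (dz (dz Φ) w - dz Φ w * dz Φ w) := by
    ext w; rw [stressEnergy, sq]
  rw [hT]
  have hsub := hdd.fun_sub (hd.fun_mul hd)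
  refine differentiableAt_of_dzbar_eq_zero (hsub.const_mul 2) ?_
  rw [dzbar_const_mul _ hsub, dzbar_sub hdd (hd.fun_mul hd), dzbar_mul hd hd, hdzbar_dz_dz,
    hdzbar_dz.self_of_nhds]
  ring

/-! ### Test functions -/

/-- Smooth complex-valued functions with compact support in `U`. -/
structure IsTestFunction (U : Set ℂ) (χ : ℂ → ℂ) : Prop where
  contDiff : ContDiff ℝ (⊤ : ℕ∞) χ
  hasCompactSupport : HasCompactSupport χ
  tsupport_subset : tsupport χ ⊆ U

section TestFunction

variable {U : Set ℂ} {F χ : ℂ → ℂ}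

namespace IsTestFunction

lemma eq_zero_of_notMem (hχ : IsTestFunction U χ) {w : ℂ} (hw : w ∉ U) : χ w = 0 :=
  image_eq_zero_of_notMem_tsupport fun h => hw (hχ.tsupport_subset h)

lemma integrable (hχ : IsTestFunction U χ) : Integrable χ :=
  hχ.contDiff.continuous.integrable_of_hasCompactSupport hχ.hasCompactSupport

lemma integrable_mul (hχ : IsTestFunction U χ) (hU : IsOpen U) (hF : ContinuousOn F U) :
    Integrable fun w => F w * χ w := by
  have hsupp : tsupport (fun w => F w * χ w) ⊆ tsupport χ := tsupport_mul_subset_right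
  refine Continuous.integrable_of_hasCompactSupport ?_ hχ.hasCompactSupport.mul_left
  exact (hF.mul hχ.contDiff.continuous.continuousOn).continuous_of_tsupport_subset hU
    (hsupp.trans hχ.tsupport_subset)

lemma of_eq_zero (hχ : IsTestFunction U χ) (hF : ContDiff ℝ (⊤ : ℕ∞) F)
    (h : ∀ w ∉ tsupport χ, F w = 0) : IsTestFunction U F where
  contDiff := hF
  hasCompactSupport := hχ.hasCompactSupport.mono' (Function.support_subset_iff'.2 h)
  tsupport_subset := (closure_minimal (Function.support_subset_iff'.2 h)
    (isClosed_tsupport χ)).trans hχ.tsupport_subset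

lemma fderiv_apply (hχ : IsTestFunction U χ) (v : ℂ) :
    IsTestFunction U fun w => fderiv ℝ χ w v :=
  hχ.of_eq_zero ((hχ.contDiff.fderiv_right (by simp)).clm_apply contDiff_const) fun w hw => by
    simp [(notMem_tsupport_iff_eventuallyEq.1 hw).fderiv_eq]

lemma mul_left (hχ : IsTestFunction U χ) (hU : IsOpen U) (hF : ContDiffOn ℝ (⊤ : ℕ∞) F U) :
    IsTestFunction U fun w => F w * χ w := by
  refine hχ.of_eq_zero (contDiff_iff_contDiffAt.2 fun w => ?_) fun w hw => by
    rw [image_eq_zero_of_notMem_tsupport hw, mul_zero]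
  by_cases hw : w ∈ tsupport χ
  · exact (hF.contDiffAt (hU.mem_nhds (hχ.tsupport_subset hw))).mul hχ.contDiff.contDiffAt
  · refine (contDiffAt_const (c := (0 : ℂ))).congr_of_eventuallyEq ?_
    filter_upwards [notMem_tsupport_iff_eventuallyEq.1 hw] with x hx
    rw [hx, Pi.zero_apply, mul_zero]

lemma const_mul (hχ : IsTestFunction U χ) (c : ℂ) : IsTestFunction U fun w => c * χ w :=
  hχ.of_eq_zero (contDiff_const.mul hχ.contDiff) fun w hw => by
    rw [image_eq_zero_of_notMem_tsupport hw, mul_zero]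

protected lemma dz (hχ : IsTestFunction U χ) : IsTestFunction U (dz χ) :=
  hχ.of_eq_zero
    (contDiff_iff_contDiffAt.2 fun _ => contDiffAt_dz hχ.contDiff.contDiffAt (by simp))
    fun _ hw => (dz_congr (notMem_tsupport_iff_eventuallyEq.1 hw)).trans (dz_const 0)

protected lemma dzbar (hχ : IsTestFunction U χ) : IsTestFunction U (dzbar χ) :=
  hχ.of_eq_zero
    (contDiff_iff_contDiffAt.2 fun _ => contDiffAt_dzbar hχ.contDiff.contDiffAt (by simp))
    fun _ hw => (dzbar_congr (notMem_tsupport_iff_eventuallyEq.1 hw)).trans (dzbar_const 0)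

lemma norm_integral_mul_le (hχ : IsTestFunction U χ) {b : ℝ} (hF : ∀ w ∈ U, ‖F w‖ ≤ b) :
    ‖∫ w, F w * χ w‖ ≤ b * ∫ w, ‖χ w‖ := by
  rw [← integral_const_mul]
  refine norm_integral_le_of_norm_le (hχ.integrable.norm.const_mul b) (.of_forall fun w => ?_)
  by_cases hw : w ∈ U
  · rw [norm_mul]
    gcongr
    exact hF w hw
  · simp [hχ.eq_zero_of_notMem hw]

lemma integral_fderiv_mul (hχ : IsTestFunction U χ) (hU : IsOpen U) (hF : ContDiffOn ℝ 1 F U)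
    (v : ℂ) : ∫ w, fderiv ℝ F w v * χ w = -∫ w, F w * fderiv ℝ χ w v := by
  rw [integral_mul_fderiv_eq_neg_fderiv_mul_of_integrable
    (hχ.integrable_mul hU ((hF.continuousOn_fderiv_of_isOpen hU le_rfl).clm_apply
      continuousOn_const))
    ((hχ.fderiv_apply v).integrable_mul hU hF.continuousOn)
    (hχ.integrable_mul hU hF.continuousOn)
    (fun w hw => (hF.contDiffAt (hU.mem_nhds (hχ.tsupport_subset hw))).differentiableAt
      one_ne_zero)
    (fun w _ => hχ.contDiff.differentiable (by simp) w), neg_neg]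

lemma integral_dz_mul (hχ : IsTestFunction U χ) (hU : IsOpen U) (hF : ContDiffOn ℝ 1 F U) :
    ∫ w, dz F w * χ w = -∫ w, F w * dz χ w := by
  have hFd (v : ℂ) := hχ.integrable_mul hU
    ((hF.continuousOn_fderiv_of_isOpen hU le_rfl).clm_apply (continuousOn_const (c := v)))
  have hχd (v : ℂ) := (hχ.fderiv_apply v).integrable_mul hU hF.continuousOn
  have hleft : (fun w => dz F w * χ w) = fun w => 2⁻¹ * (fderiv ℝ F w 1 * χ w) -
      Complex.I / 2 * (fderiv ℝ F w Complex.I * χ w) := by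
    ext w; simp only [ConicalSphere.dz]; ring
  have hright : (fun w => F w * dz χ w) = fun w => 2⁻¹ * (F w * fderiv ℝ χ w 1) -
      Complex.I / 2 * (F w * fderiv ℝ χ w Complex.I) := by
    ext w; simp only [ConicalSphere.dz]; ring
  rw [hleft, hright, integral_sub ((hFd _).const_mul _) ((hFd _).const_mul _),
    integral_sub ((hχd _).const_mul _) ((hχd _).const_mul _)]
  simp only [integral_const_mul, hχ.integral_fderiv_mul hU hF]
  ring

lemma integral_dzbar_mul (hχ : IsTestFunction U χ) (hU : IsOpen U) (hF : ContDiffOn ℝ 1 F U) :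
    ∫ w, dzbar F w * χ w = -∫ w, F w * dzbar χ w := by
  have hFd (v : ℂ) := hχ.integrable_mul hU
    ((hF.continuousOn_fderiv_of_isOpen hU le_rfl).clm_apply (continuousOn_const (c := v)))
  have hχd (v : ℂ) := (hχ.fderiv_apply v).integrable_mul hU hF.continuousOn
  have hleft : (fun w => dzbar F w * χ w) = fun w => 2⁻¹ * (fderiv ℝ F w 1 * χ w) +
      Complex.I / 2 * (fderiv ℝ F w Complex.I * χ w) := by
    ext w; simp only [ConicalSphere.dzbar]; ring
  have hright : (fun w => F w * dzbar χ w) = fun w => 2⁻¹ * (F w * fderiv ℝ χ w 1) +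
      Complex.I / 2 * (F w * fderiv ℝ χ w Complex.I) := by
    ext w; simp only [ConicalSphere.dzbar]; ring
  rw [hleft, hright, integral_add ((hFd _).const_mul _) ((hFd _).const_mul _),
    integral_add ((hχd _).const_mul _) ((hχd _).const_mul _)]
  simp only [integral_const_mul, hχ.integral_fderiv_mul hU hF]
  ring

end IsTestFunction

/-! ### A test function with the mean value property -/

lemma contDiff_radial (a : ℂ) {ρ : ℝ → ℝ} (hρ : ContDiff ℝ (⊤ : ℕ∞) ρ) :
    ContDiff ℝ (⊤ : ℕ∞) fun w => ((ρ (‖w - a‖ ^ 2) : ℝ) : ℂ) :=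
  Complex.ofRealCLM.contDiff.comp (hρ.comp ((contDiff_id.sub contDiff_const).norm_sq ℝ))

lemma isTestFunction_radial (a : ℂ) {ρ : ℝ → ℝ} {s r : ℝ} (hρ : ContDiff ℝ (⊤ : ℕ∞) ρ)
    (hs : 0 ≤ s) (hsr : s < r) (hzero : ∀ t, s ^ 2 < t → ρ t = 0) :
    IsTestFunction (Metric.ball a r) fun w => ((ρ (‖w - a‖ ^ 2) : ℝ) : ℂ) := by
  have hsupp : tsupport (fun w => ((ρ (‖w - a‖ ^ 2) : ℝ) : ℂ)) ⊆ Metric.closedBall a s := by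
    refine closure_minimal (Function.support_subset_iff'.2 fun w hw => ?_)
      Metric.isClosed_closedBall
    rw [Metric.mem_closedBall, dist_eq_norm, not_le] at hw
    rw [hzero _ (by gcongr), Complex.ofReal_zero]
  exact ⟨contDiff_radial a hρ,
    (isCompact_closedBall a s).of_isClosed_subset (isClosed_tsupport _) hsupp,
    hsupp.trans (Metric.closedBall_subset_ball hsr)⟩

lemma dzbar_radial {ρ : ℝ → ℝ} {a w : ℂ} (hρ : DifferentiableAt ℝ ρ (‖w - a‖ ^ 2)) :
    dzbar (fun w => ((ρ (‖w - a‖ ^ 2) : ℝ) : ℂ)) w =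
      (w - a) * (deriv ρ (‖w - a‖ ^ 2) : ℝ) := by
  have hsq : HasFDerivAt (fun w : ℂ => ‖w - a‖ ^ 2) (2 • innerSL ℝ (w - a)) w := by
    simpa using ((hasFDerivAt_id (𝕜 := ℝ) w).sub_const a).norm_sq
  have hfderiv := (Complex.ofRealCLM.hasFDerivAt.comp w
    (hρ.hasDerivAt.comp_hasFDerivAt w hsq)).fderiv
  refine dzbar_eq_of_fderiv_apply (a := conj (w - a) * (deriv ρ (‖w - a‖ ^ 2) : ℝ)) fun v => ?_
  have hinner : (2 : ℂ) * (v * conj (w - a)).re = v * conj (w - a) + conj v * (w - a) := by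
    rw [Complex.re_eq_add_conj, map_mul, Complex.conj_conj]; ring
  have happly : fderiv ℝ (fun w => ((ρ (‖w - a‖ ^ 2) : ℝ) : ℂ)) w v =
      (deriv ρ (‖w - a‖ ^ 2) : ℝ) * (2 * ((v * conj (w - a)).re : ℂ)) := by
    refine (congrArg (· v) hfderiv).trans ?_
    simp [Complex.inner, -Complex.mul_re, -map_sub]
  rw [happly, hinner]
  ring

lemma isTestFunction_deriv_radial (a : ℂ) {ρ : ℝ → ℝ} {s r : ℝ} (hρ : ContDiff ℝ (⊤ : ℕ∞) ρ)
    (hs : 0 ≤ s) (hsr : s < r) (hzero : ∀ t, s ^ 2 < t → ρ t = 0) :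
    IsTestFunction (Metric.ball a r) fun w => ((deriv ρ (‖w - a‖ ^ 2) : ℝ) : ℂ) := by
  refine isTestFunction_radial a (contDiff_infty_iff_deriv.1 hρ).2 hs hsr fun t ht => ?_
  have hloc : ρ =ᶠ[𝓝 t] fun _ => 0 := by
    filter_upwards [lt_mem_nhds ht] with t' ht' using hzero t' ht'
  rw [hloc.deriv_eq, deriv_const]

lemma integral_mul_deriv_radial (a : ℂ) {ρ : ℝ → ℝ} {s r : ℝ} (hρ : ContDiff ℝ (⊤ : ℕ∞) ρ)
    (hs : 0 ≤ s) (hsr : s < r) (hzero : ∀ t, s ^ 2 < t → ρ t = 0) {H : ℂ → ℂ}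
    (hH : DifferentiableOn ℂ H (Metric.ball a r)) :
    ∫ w, H w * (deriv ρ (‖w - a‖ ^ 2) : ℝ) = H a * ∫ w, ((deriv ρ (‖w - a‖ ^ 2) : ℝ) : ℂ) := by
  have hU : IsOpen (Metric.ball a r) := Metric.isOpen_ball
  have hK : DifferentiableOn ℂ (dslope H a) (Metric.ball a r) :=
    (Complex.differentiableOn_dslope (Metric.ball_mem_nhds a (hs.trans_lt hsr))).2 hH
  have hK' : ContDiffOn ℝ 1 (dslope H a) (Metric.ball a r) :=
    (hK.contDiffOn hU).restrict_scalars ℝ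
  have hχ := isTestFunction_radial a hρ hs hsr hzero
  have hχ' := isTestFunction_deriv_radial a hρ hs hsr hzero
  have hparts := hχ.integral_dzbar_mul hU hK'
  have hleft : (fun w => dzbar (dslope H a) w * (ρ (‖w - a‖ ^ 2) : ℝ)) = fun _ => 0 := by
    ext w
    by_cases hw : w ∈ Metric.ball a r
    · rw [dzbar_of_differentiableAt (hK.differentiableAt (hU.mem_nhds hw)), zero_mul]
    · exact mul_eq_zero_of_right _ (hχ.eq_zero_of_notMem hw)
  have hright : (fun w => dslope H a w * dzbar (fun w => ((ρ (‖w - a‖ ^ 2) : ℝ) : ℂ)) w) =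
      fun w => H w * (deriv ρ (‖w - a‖ ^ 2) : ℝ) - H a * (deriv ρ (‖w - a‖ ^ 2) : ℝ) := by
    ext w
    rw [dzbar_radial (hρ.differentiable (by simp) _)]
    linear_combination ((deriv ρ (‖w - a‖ ^ 2) : ℝ) : ℂ) * sub_smul_dslope H a w
  rw [hleft, hright, integral_sub (hχ'.integrable_mul hU hH.continuousOn)
    (hχ'.integrable.const_mul _), integral_const_mul, integral_zero] at hparts
  linear_combination hparts

lemma integral_deriv_radial_pos (a : ℂ) {ρ : ℝ → ℝ} {s : ℝ} (hρ : ContDiff ℝ (⊤ : ℕ∞) ρ)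
    (hs : 0 < s) (hzero : ∀ t, s ^ 2 ≤ t → ρ t = 0) (hmono : Monotone ρ) (hρ0 : ρ 0 ≠ 0) :
    0 < ∫ w : ℂ, deriv ρ (‖w - a‖ ^ 2) := by
  have hχ := isTestFunction_deriv_radial a hρ hs.le (lt_add_one s) fun t ht => hzero t ht.le
  have hcont : Continuous fun w : ℂ => deriv ρ (‖w - a‖ ^ 2) :=
    (hρ.continuous_deriv (by simp)).comp (by fun_prop)
  have hcomp : HasCompactSupport fun w : ℂ => deriv ρ (‖w - a‖ ^ 2) := by
    simpa [Function.comp_def] using hχ.hasCompactSupport.comp_left (g := Complex.re) rfl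
  obtain ⟨t, ht, hderiv⟩ : ∃ t ∈ Set.Ioo 0 (s ^ 2), deriv ρ t = (ρ (s ^ 2) - ρ 0) / (s ^ 2 - 0) :=
    exists_deriv_eq_slope ρ (by positivity) hρ.continuous.continuousOn
      (hρ.differentiable (by simp)).differentiableOn
  refine hcont.integral_pos_of_hasCompactSupport_nonneg_nonzero hcomp
    (fun w => hmono.deriv_nonneg) (x := a + (Real.sqrt t : ℂ)) ?_
  rw [add_sub_cancel_left, Complex.norm_real, Real.norm_eq_abs, sq_abs, Real.sq_sqrt ht.1.le,
    hderiv, hzero _ le_rfl]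
  exact div_ne_zero (by simpa using hρ0) (by simpa using hs.ne')

theorem exists_testFunction_integral_mul_eq (a : ℂ) {r : ℝ} (hr : 0 < r) :
    ∃ χ, IsTestFunction (Metric.ball a r) χ ∧ (∀ w, (‖χ w‖ : ℂ) = χ w) ∧
      ∀ H, DifferentiableOn ℂ H (Metric.ball a r) → ∫ w, H w * χ w = H a := by
  set s : ℝ := r / 2
  have hs : 0 < s := half_pos hr
  have hsr : s < r := half_lt_self hr
  set ρ : ℝ → ℝ := fun t => Real.smoothTransition (t / s ^ 2) - 1
  have hρ : ContDiff ℝ (⊤ : ℕ∞) ρ :=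
    (Real.smoothTransition.contDiff.comp (contDiff_id.div_const _)).sub contDiff_const
  have hzero (t : ℝ) (ht : s ^ 2 ≤ t) : ρ t = 0 :=
    sub_eq_zero.2 (Real.smoothTransition.one_of_one_le ((one_le_div (by positivity)).2 ht))
  have hmono : Monotone ρ := fun t t' h =>
    sub_le_sub_right (Real.smoothTransition.monotone (by gcongr)) 1
  have hpos := integral_deriv_radial_pos a hρ hs hzero hmono (by simp [ρ])
  set c : ℝ := ∫ w : ℂ, deriv ρ (‖w - a‖ ^ 2) with hc
  refine ⟨_, (isTestFunction_deriv_radial a hρ hs.le hsr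
    fun t ht => hzero t ht.le).const_mul (c⁻¹ : ℝ), fun w => ?_, fun H hH => ?_⟩
  · rw [← Complex.ofReal_mul, Complex.norm_of_nonneg
      (mul_nonneg (inv_nonneg.2 hpos.le) hmono.deriv_nonneg)]
  · have hc0 : (c : ℂ) ≠ 0 := Complex.ofReal_ne_zero.2 hpos.ne'
    simp only [mul_left_comm _ ((c⁻¹ : ℝ) : ℂ)]
    rw [integral_const_mul,
      integral_mul_deriv_radial a hρ hs.le hsr (fun t ht => hzero t ht.le) hH,
      integral_complex_ofReal, ← hc, Complex.ofReal_inv, mul_comm (H a),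
      inv_mul_cancel_left₀ hc0]

end TestFunction

/-! ### An interior estimate -/

section InteriorEstimate

variable {U : Set ℂ} {χ : ℂ → ℂ} {u : ℂ → ℝ}

lemma dz_dzbar_sq {z : ℂ} (hu : ContDiffAt ℝ 2 (fun w => (u w : ℂ)) z) :
    dz (dzbar fun w => (u w : ℂ) ^ 2) z =
      2 * (‖dz (fun w => (u w : ℂ)) z‖ : ℂ) ^ 2 + 2 * (u z * dz (dzbar fun w => (u w : ℂ)) z) := by
  have hd : DifferentiableAt ℝ (fun w => (u w : ℂ)) z := hu.differentiableAt (by simp)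
  have hdzbar : DifferentiableAt ℝ (dzbar fun w => (u w : ℂ)) z :=
    (contDiffAt_dzbar (m := 1) hu (by norm_num)).differentiableAt (by simp)
  have hloc : (dzbar fun w => (u w : ℂ) ^ 2) =ᶠ[𝓝 z]
      fun w => 2 * (u w * dzbar (fun w => (u w : ℂ)) w) := by
    filter_upwards [hu.eventually (by simp)] with w hw
    have hdw : DifferentiableAt ℝ (fun w => (u w : ℂ)) w := hw.differentiableAt (by simp)
    simp only [sq]
    rw [dzbar_mul hdw hdw]
    ring
  rw [dz_congr hloc, dz_const_mul _ (hd.fun_mul hdzbar), dz_mul hd hdzbar,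
    dzbar_ofReal_eq_conj_dz hd, Complex.mul_conj']
  ring

lemma IsTestFunction.integral_normSq_dz_mul (hχ : IsTestFunction U χ) (hU : IsOpen U)
    (hu : ContDiffOn ℝ 2 (fun w => (u w : ℂ)) U) :
    ∫ w, (‖dz (fun w => (u w : ℂ)) w‖ : ℂ) ^ 2 * χ w =
      1 / 2 * (∫ w, (u w : ℂ) ^ 2 * dzbar (dz χ) w) -
        ∫ w, u w * dz (dzbar fun w => (u w : ℂ)) w * χ w := by
  have hsq : ContDiffOn ℝ 2 (fun w => (u w : ℂ) ^ 2) U := hu.pow 2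
  have hdzsq : ContDiffOn ℝ 1 (dzbar fun w => (u w : ℂ) ^ 2) U :=
    contDiffOn_dzbar hsq hU (by norm_num)
  have hparts : ∫ w, dz (dzbar fun w => (u w : ℂ) ^ 2) w * χ w =
      ∫ w, (u w : ℂ) ^ 2 * dzbar (dz χ) w := by
    rw [hχ.integral_dz_mul hU hdzsq, hχ.dz.integral_dzbar_mul hU (hsq.of_le (by norm_num)), neg_neg]
  have hdz : ContinuousOn (dz fun w => (u w : ℂ)) U :=
    (contDiffOn_dz (m := 1) hu hU (by norm_num)).continuousOn
  have hdzdzbar : ContinuousOn (dz (dzbar fun w => (u w : ℂ))) U :=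
    (contDiffOn_dz (m := 0) (contDiffOn_dzbar (m := 1) hu hU (by norm_num)) hU
      (by norm_num)).continuousOn
  have hexpand : (fun w => dz (dzbar fun w => (u w : ℂ) ^ 2) w * χ w) = fun w =>
      2 * ((‖dz (fun w => (u w : ℂ)) w‖ : ℂ) ^ 2 * χ w) +
        2 * (u w * dz (dzbar fun w => (u w : ℂ)) w * χ w) := by
    ext w
    by_cases hw : w ∈ U
    · rw [dz_dzbar_sq (hu.contDiffAt (hU.mem_nhds hw))]
      ring
    · simp [hχ.eq_zero_of_notMem hw]
  rw [← hparts, hexpand, integral_add, integral_const_mul, integral_const_mul]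
  · ring
  · exact (hχ.integrable_mul hU
      ((Complex.continuous_ofReal.comp_continuousOn hdz.norm).pow 2)).const_mul 2
  · exact (hχ.integrable_mul hU (hu.continuousOn.mul hdzdzbar)).const_mul 2

lemma IsTestFunction.norm_integral_dz_sq_mul_le (hχ : IsTestFunction U χ) (hU : IsOpen U)
    (hχ0 : ∀ w, (‖χ w‖ : ℂ) = χ w) (hu : ContDiffOn ℝ 2 (fun w => (u w : ℂ)) U) {ε δ : ℝ}
    (hε : ∀ w ∈ U, |u w| ≤ ε) (hδ : ∀ w ∈ U, ‖dz (dzbar fun w => (u w : ℂ)) w‖ ≤ δ) :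
    ‖∫ w, dz (fun w => (u w : ℂ)) w ^ 2 * χ w‖ ≤
      ε ^ 2 * (∫ w, ‖dzbar (dz χ) w‖) + ε * δ * ∫ w, ‖χ w‖ := by
  have henergy : ∫ w, ‖dz (fun w => (u w : ℂ)) w ^ 2 * χ w‖ =
      ‖∫ w, (‖dz (fun w => (u w : ℂ)) w‖ : ℂ) ^ 2 * χ w‖ := by
    have hreal : (fun w => (‖dz (fun w => (u w : ℂ)) w‖ : ℂ) ^ 2 * χ w) =
        fun w => ((‖dz (fun w => (u w : ℂ)) w ^ 2 * χ w‖ : ℝ) : ℂ) := by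
      ext w
      rw [norm_mul, norm_pow, Complex.ofReal_mul, Complex.ofReal_pow, hχ0]
    rw [hreal, integral_complex_ofReal, Complex.norm_of_nonneg
      (integral_nonneg fun w => norm_nonneg _)]
  have hsq : ‖∫ w, (u w : ℂ) ^ 2 * dzbar (dz χ) w‖ ≤ ε ^ 2 * ∫ w, ‖dzbar (dz χ) w‖ :=
    hχ.dz.dzbar.norm_integral_mul_le fun w hw => by
      rw [norm_pow, Complex.norm_real, Real.norm_eq_abs]
      gcongr
      exact hε w hw
  have hlap : ‖∫ w, u w * dz (dzbar fun w => (u w : ℂ)) w * χ w‖ ≤ ε * δ * ∫ w, ‖χ w‖ :=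
    hχ.norm_integral_mul_le fun w hw => by
      rw [norm_mul, Complex.norm_real, Real.norm_eq_abs]
      exact mul_le_mul (hε w hw) (hδ w hw) (norm_nonneg _) ((abs_nonneg _).trans (hε w hw))
  refine (norm_integral_le_integral_norm _).trans ?_
  rw [henergy, hχ.integral_normSq_dz_mul hU hu]
  refine (norm_sub_le _ _).trans (add_le_add ?_ hlap)
  rw [norm_mul, show ‖(1 / 2 : ℂ)‖ = 1 / 2 by norm_num]
  linarith [norm_nonneg (∫ w, (u w : ℂ) ^ 2 * dzbar (dz χ) w)]

/-- The stress-energy tensor of a potential near `v`: if `g = ∂v`, it is `T_{v+u} - T_v`. -/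
def relStressEnergy (g : ℂ → ℂ) (u : ℂ → ℝ) (z : ℂ) : ℂ :=
  stressEnergy u z - 4 * g z * dz (fun w => (u w : ℂ)) z

lemma IsTestFunction.integral_relStressEnergy_mul (hχ : IsTestFunction U χ) (hU : IsOpen U)
    {g : ℂ → ℂ} (hg : ContDiffOn ℝ (⊤ : ℕ∞) g U) (hu : ContDiffOn ℝ 2 (fun w => (u w : ℂ)) U) :
    ∫ w, relStressEnergy g u w * χ w =
      2 * (∫ w, u w * dz (dz χ) w) - 2 * (∫ w, dz (fun w => (u w : ℂ)) w ^ 2 * χ w) +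
        4 * ∫ w, u w * dz (fun w => g w * χ w) w := by
  have hdz : ContDiffOn ℝ 1 (dz fun w => (u w : ℂ)) U := contDiffOn_dz hu hU (by norm_num)
  have hdzdz : ContinuousOn (dz (dz fun w => (u w : ℂ))) U :=
    (contDiffOn_dz (m := 0) hdz hU (by norm_num)).continuousOn
  have hu1 : ContDiffOn ℝ 1 (fun w => (u w : ℂ)) U := hu.of_le (by norm_num)
  have hgχ := hχ.mul_left hU hg
  have hexpand : (fun w => relStressEnergy g u w * χ w) = fun w =>
      2 * (dz (dz fun w => (u w : ℂ)) w * χ w) - 2 * (dz (fun w => (u w : ℂ)) w ^ 2 * χ w) -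
        4 * (dz (fun w => (u w : ℂ)) w * (g w * χ w)) := by
    ext w; rw [relStressEnergy, stressEnergy]; ring
  have hint₁ := (hχ.integrable_mul hU hdzdz).const_mul 2
  have hint₂ := (hχ.integrable_mul hU (hdz.continuousOn.fun_pow 2)).const_mul 2
  have hint₃ := (hgχ.integrable_mul hU hdz.continuousOn).const_mul 4
  rw [hexpand, integral_sub (by exact hint₁.sub hint₂) hint₃, integral_sub hint₁ hint₂]
  simp only [integral_const_mul]
  rw [hχ.integral_dz_mul hU hdz, hχ.dz.integral_dz_mul hU hu1, hgχ.integral_dz_mul hU hu1]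
  ring

/-- As the tensor is holomorphic, its value at `a` is an average against a test function `χ`. All
derivatives of `u` can be moved to `χ` except in the quadratic term, which is at most the Dirichlet
energy of `u`. -/
theorem exists_norm_relStressEnergy_le (a : ℂ) {r : ℝ} (hr : 0 < r) {g : ℂ → ℂ}
    (hg : ContDiffOn ℝ (⊤ : ℕ∞) g (Metric.ball a r)) :
    ∃ C, ∀ (u : ℂ → ℝ) (ε δ : ℝ),
      ContDiffOn ℝ 2 (fun w => (u w : ℂ)) (Metric.ball a r) →
      (∀ w ∈ Metric.ball a r, |u w| ≤ ε) →
      (∀ w ∈ Metric.ball a r, ‖dz (dzbar fun w => (u w : ℂ)) w‖ ≤ δ) →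
      DifferentiableOn ℂ (relStressEnergy g u) (Metric.ball a r) →
      ‖relStressEnergy g u a‖ ≤ C * (ε * (1 + ε + δ)) := by
  obtain ⟨χ, hχ, hχ0, hmean⟩ := exists_testFunction_integral_mul_eq a hr
  have hU : IsOpen (Metric.ball a r) := Metric.isOpen_ball
  set A := ∫ w, ‖dz (dz χ) w‖
  set B := ∫ w, ‖dzbar (dz χ) w‖
  set M := ∫ w, ‖χ w‖
  set G := ∫ w, ‖dz (fun w => g w * χ w) w‖
  refine ⟨2 * A + 2 * B + 2 * M + 4 * G, fun u ε δ hu hε hδ hD => ?_⟩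
  have hu0 : ∀ w ∈ Metric.ball a r, ‖(u w : ℂ)‖ ≤ ε := by simpa using hε
  have hA := hχ.dz.dz.norm_integral_mul_le hu0
  have hG := (hχ.mul_left hU hg).dz.norm_integral_mul_le hu0
  have hsq := hχ.norm_integral_dz_sq_mul_le hU hχ0 hu hε hδ
  have ha : a ∈ Metric.ball a r := Metric.mem_ball_self hr
  have hε0 : 0 ≤ ε := (abs_nonneg _).trans (hε a ha)
  have hδ0 : 0 ≤ δ := (norm_nonneg _).trans (hδ a ha)
  have hnonneg (F : ℂ → ℂ) : 0 ≤ ∫ w, ‖F w‖ := integral_nonneg fun w => norm_nonneg _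
  have : 0 ≤ A := hnonneg _
  have : 0 ≤ B := hnonneg _
  have : 0 ≤ M := hnonneg _
  have : 0 ≤ G := hnonneg _
  rw [← hmean _ hD, hχ.integral_relStressEnergy_mul hU hg hu]
  refine ((norm_add_le _ _).trans (add_le_add_left (norm_sub_le _ _) _)).trans ?_
  simp only [norm_mul, Complex.norm_ofNat]
  calc _ ≤ 2 * (ε * A) + 2 * (ε ^ 2 * B + ε * δ * M) + 4 * (ε * G) := by gcongr
    _ ≤ (2 * A + 2 * B + 2 * M + 4 * G) * (ε * (1 + ε + δ)) := by
      have : 0 ≤ ε * (2 * A * (ε + δ) + 2 * B * (1 + δ) + 2 * M * (1 + ε) + 4 * G * (ε + δ)) := by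
        positivity
      linarith

end InteriorEstimate

/-! ### The stress-energy tensor near a conical singularity -/

section ConicalSingularity

variable {u φ : ℂ → ℝ} {z w : ℂ}

lemma dz_comp_mul_left {F : ℂ → ℂ} (hF : DifferentiableAt ℝ F (z * w)) :
    dz (fun x => F (z * x)) w = z * dz F (z * w) := by
  rw [dz_comp_holomorphic (f := fun x => z * x) hF (by fun_prop), deriv_const_mul_id', mul_comm]

lemma dzbar_comp_mul_left {F : ℂ → ℂ} (hF : DifferentiableAt ℝ F (z * w)) :
    dzbar (fun x => F (z * x)) w = conj z * dzbar F (z * w) := by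
  rw [dzbar_comp_holomorphic (f := fun x => z * x) hF (by fun_prop), deriv_const_mul_id', mul_comm]

lemma eventually_contDiffAt_comp_mul_left (hu : ContDiffAt ℝ 2 (fun x => (u x : ℂ)) (z * w)) :
    ∀ᶠ x in 𝓝 w, ContDiffAt ℝ 2 (fun x => (u x : ℂ)) (z * x) :=
  (continuous_const_mul z).continuousAt.eventually (hu.eventually (by simp))

lemma dz_dzbar_comp_mul_left (hu : ContDiffAt ℝ 2 (fun x => (u x : ℂ)) (z * w)) :
    dz (dzbar fun x => (u (z * x) : ℂ)) w =
      (‖z‖ : ℂ) ^ 2 * dz (dzbar fun x => (u x : ℂ)) (z * w) := by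
  have hdzbar : DifferentiableAt ℝ (dzbar fun x => (u x : ℂ)) (z * w) :=
    (contDiffAt_dzbar (m := 1) hu (by norm_num)).differentiableAt (by simp)
  have hloc : (dzbar fun x => (u (z * x) : ℂ)) =ᶠ[𝓝 w]
      fun x => conj z * dzbar (fun x => (u x : ℂ)) (z * x) := by
    filter_upwards [eventually_contDiffAt_comp_mul_left hu] with x hx
    exact dzbar_comp_mul_left (hx.differentiableAt (by simp))
  rw [dz_congr hloc, dz_const_mul _ (hdzbar.fun_comp' w (by fun_prop)), dz_comp_mul_left hdzbar,
    ← mul_assoc, Complex.conj_mul']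

lemma relStressEnergy_comp_mul_left {g : ℂ → ℂ}
    (hu : ContDiffAt ℝ 2 (fun x => (u x : ℂ)) (z * w)) (hg : g w = z * g (z * w)) :
    relStressEnergy g (fun x => u (z * x)) w = z ^ 2 * relStressEnergy g u (z * w) := by
  have hdz : DifferentiableAt ℝ (dz fun x => (u x : ℂ)) (z * w) :=
    (contDiffAt_dz (m := 1) hu (by norm_num)).differentiableAt (by simp)
  have hloc : (dz fun x => (u (z * x) : ℂ)) =ᶠ[𝓝 w]
      fun x => z * dz (fun x => (u x : ℂ)) (z * x) := by
    filter_upwards [eventually_contDiffAt_comp_mul_left hu] with x hx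
    exact dz_comp_mul_left (hx.differentiableAt (by simp))
  rw [relStressEnergy, relStressEnergy, stressEnergy, stressEnergy, dz_congr hloc,
    hloc.self_of_nhds, dz_const_mul _ (hdz.fun_comp' w (by fun_prop)), dz_comp_mul_left hdz, hg]
  ring

lemma half_le_norm_of_mem_ball (hw : w ∈ Metric.ball (1 : ℂ) (1 / 2)) : 1 / 2 ≤ ‖w‖ := by
  have hdist := norm_sub_norm_le 1 w
  rw [Metric.mem_ball', dist_eq_norm] at hw
  rw [norm_one] at hdist
  linarith

/-- The interior estimate on the disc `ball 1 (1 / 2)`, applied to the rescaled potential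
`w ↦ u (z * w)`; the term `k / w` is the one that is invariant under this scaling. -/
theorem tendsto_sq_mul_relStressEnergy {l : Filter ℂ} {k : ℂ}
    (hl : Tendsto (fun p : ℂ × ℂ => p.1 * p.2) (l ×ˢ 𝓟 (Metric.ball 1 (1 / 2))) l)
    (hl0 : ∀ᶠ z in l, z ≠ 0) (hu : ∀ᶠ z in l, ContDiffAt ℝ 2 (fun w => (u w : ℂ)) z)
    (hT : ∀ᶠ z in l, DifferentiableAt ℂ (relStressEnergy (fun w => k / w) u) z)
    (hu0 : Tendsto u l (𝓝 0))
    (hlap : Tendsto (fun z => ‖z‖ ^ 2 * ‖dz (dzbar fun w => (u w : ℂ)) z‖) l (𝓝 0)) :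
    Tendsto (fun z => z ^ 2 * relStressEnergy (fun w => k / w) u z) l (𝓝 0) := by
  have hball {p : ℂ → Prop} (hp : ∀ᶠ z in l, p z) :
      ∀ᶠ z in l, ∀ w ∈ Metric.ball (1 : ℂ) (1 / 2), p (z * w) :=
    eventually_prod_principal_iff.1 (hl.eventually hp)
  have hne {w : ℂ} (hw : w ∈ Metric.ball (1 : ℂ) (1 / 2)) : w ≠ 0 :=
    norm_pos_iff.1 (by linarith [half_le_norm_of_mem_ball hw])
  have hdiv : ContDiffOn ℝ (⊤ : ℕ∞) (fun w => k / w) (Metric.ball (1 : ℂ) (1 / 2)) := fun w hw =>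
    ((contDiffAt_const.div contDiffAt_id (hne hw)).restrict_scalars ℝ).contDiffWithinAt
  obtain ⟨C, hC⟩ := exists_norm_relStressEnergy_le 1 one_half_pos hdiv
  have hsmall : Tendsto (fun η : ℝ => C * (η * (1 + η + 4 * η))) (𝓝[>] 0) (𝓝 0) := by
    refine tendsto_nhdsWithin_of_tendsto_nhds (Continuous.tendsto' (by fun_prop) _ _ (by simp))
  rw [tendsto_zero_iff_norm_tendsto_zero, Metric.tendsto_nhds]
  intro e he
  obtain ⟨η, hη, hη0⟩ := ((hsmall.eventually_lt_const he).and self_mem_nhdsWithin).exists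
  filter_upwards [hball hu, hball hT, hl0,
    hball (hu0.eventually (Metric.closedBall_mem_nhds 0 hη0)),
    hball (hlap.eventually (ge_mem_nhds hη0))] with z huz hTz hz hu0z hlapz
  have hscale {w : ℂ} (hw : w ∈ Metric.ball (1 : ℂ) (1 / 2)) :
      relStressEnergy (fun w => k / w) (fun x => u (z * x)) w =
        z ^ 2 * relStressEnergy (fun w => k / w) u (z * w) :=
    relStressEnergy_comp_mul_left (huz w hw) (by have := hne hw; field_simp)
  have hone : (1 : ℂ) ∈ Metric.ball (1 : ℂ) (1 / 2) := Metric.mem_ball_self one_half_pos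
  have hest := hC (fun x => u (z * x)) η (4 * η)
    (fun w hw => ((huz w hw).fun_comp w (by fun_prop)).contDiffWithinAt)
    (fun w hw => by simpa using hu0z w hw) (fun w hw => ?_) (fun w hw => ?_)
  · rw [hscale hone, mul_one] at hest
    rw [dist_zero_right, norm_norm]
    exact hest.trans_lt hη
  · rw [dz_dzbar_comp_mul_left (huz w hw), norm_mul, norm_pow, Complex.norm_real, norm_norm]
    have hlapw := hlapz w hw
    rw [norm_mul, mul_pow, mul_right_comm] at hlapw
    have hw_sq : 1 / 4 ≤ ‖w‖ ^ 2 := by nlinarith [half_le_norm_of_mem_ball hw]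
    have hnonneg : 0 ≤ ‖z‖ ^ 2 * ‖dz (dzbar fun x => (u x : ℂ)) (z * w)‖ := by positivity
    nlinarith
  · exact (((hTz w hw).fun_comp' w (by fun_prop)).const_mul _).differentiableWithinAt.congr
      (fun x hx => hscale hx) (hscale hw)

lemma dz_sub_log (hφ : DifferentiableAt ℝ (fun w => (φ w : ℂ)) z) (hz : z ≠ 0) (γ c : ℝ) :
    dz (fun w => ((φ w - γ * Real.log ‖w‖ - c : ℝ) : ℂ)) z =
      dz (fun w => (φ w : ℂ)) z + -(γ / 2 : ℂ) * z⁻¹ := by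
  have hlog : DifferentiableAt ℝ (fun w => ((Real.log ‖w‖ : ℝ) : ℂ)) z :=
    (contDiffAt_log_norm (n := 1) hz).differentiableAt (by simp)
  have hsum : (fun w => ((φ w - γ * Real.log ‖w‖ - c : ℝ) : ℂ)) =
      fun w => φ w + (-(γ : ℂ) * ((Real.log ‖w‖ : ℝ) : ℂ) + -(c : ℂ)) := by
    ext w; push_cast; ring
  rw [hsum, dz_add hφ ((hlog.const_mul _).add_const _), dz_add (hlog.const_mul _) (by fun_prop),
    dz_const_mul _ hlog, dz_const, dz_log_norm hz]
  ring

lemma eventually_dz_sub_log (hφ : ContDiffAt ℝ 2 (fun w => (φ w : ℂ)) z) (hz : z ≠ 0) (γ c : ℝ) :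
    dz (fun w => ((φ w - γ * Real.log ‖w‖ - c : ℝ) : ℂ)) =ᶠ[𝓝 z]
      fun w => dz (fun w => (φ w : ℂ)) w + -(γ / 2 : ℂ) * w⁻¹ := by
  filter_upwards [hφ.eventually (by simp), isOpen_ne.mem_nhds hz] with w hφw hw
  exact dz_sub_log (hφw.differentiableAt (by simp)) hw γ c

lemma contDiffAt_sub_log (hφ : ContDiffAt ℝ 2 (fun w => (φ w : ℂ)) z) (hz : z ≠ 0) (γ c : ℝ) :
    ContDiffAt ℝ 2 (fun w => ((φ w - γ * Real.log ‖w‖ - c : ℝ) : ℂ)) z := by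
  push_cast
  exact (hφ.sub (contDiffAt_const.mul (contDiffAt_log_norm hz))).sub contDiffAt_const

lemma relStressEnergy_sub_log (hφ : ContDiffAt ℝ 2 (fun w => (φ w : ℂ)) z) (hz : z ≠ 0)
    (γ c : ℝ) :
    relStressEnergy (fun w => (γ / 2 : ℂ) / w) (fun w => φ w - γ * Real.log ‖w‖ - c) z =
      stressEnergy φ z + γ * (γ + 2) / 2 / z ^ 2 := by
  have hloc := eventually_dz_sub_log hφ hz γ c
  have hdz : DifferentiableAt ℝ (dz fun w => (φ w : ℂ)) z :=
    (contDiffAt_dz (m := 1) hφ (by norm_num)).differentiableAt (by simp)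
  have hinv : DifferentiableAt ℂ (fun w : ℂ => w⁻¹) z := differentiableAt_inv hz
  rw [relStressEnergy, stressEnergy, stressEnergy, dz_congr hloc, hloc.self_of_nhds,
    dz_add hdz (hinv.real_of_complex.const_mul _), dz_const_mul _ hinv.real_of_complex,
    dz_of_differentiableAt hinv, deriv_inv]
  field_simp
  ring

lemma dz_dzbar_sub_log (hφ : ContDiffAt ℝ 2 (fun w => (φ w : ℂ)) z) (hz : z ≠ 0) (γ c : ℝ) :
    dz (dzbar fun w => ((φ w - γ * Real.log ‖w‖ - c : ℝ) : ℂ)) z =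
      dz (dzbar fun w => (φ w : ℂ)) z := by
  have hdz : DifferentiableAt ℝ (dz fun w => (φ w : ℂ)) z :=
    (contDiffAt_dz (m := 1) hφ (by norm_num)).differentiableAt (by simp)
  have hinv : DifferentiableAt ℂ (fun w : ℂ => w⁻¹) z := differentiableAt_inv hz
  rw [dz_dzbar_comm (contDiffAt_sub_log hφ hz γ c), dz_dzbar_comm hφ,
    dzbar_congr (eventually_dz_sub_log hφ hz γ c),
    dzbar_add hdz (hinv.real_of_complex.const_mul _), dzbar_const_mul _ hinv.real_of_complex,
    dzbar_of_differentiableAt hinv, mul_zero, add_zero]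

theorem tendsto_sq_mul_stressEnergy {l : Filter ℂ} {γ c : ℝ} {κ : ℂ}
    (hl : Tendsto (fun p : ℂ × ℂ => p.1 * p.2) (l ×ˢ 𝓟 (Metric.ball 1 (1 / 2))) l)
    (hl0 : ∀ᶠ z in l, z ≠ 0) (hφ : ∀ᶠ z in l, ContDiffAt ℝ 2 (fun w => (φ w : ℂ)) z)
    (hT : ∀ᶠ z in l, DifferentiableAt ℂ (stressEnergy φ) z)
    (hL : ∀ᶠ z in l, dz (dzbar fun w => (φ w : ℂ)) z = κ * Complex.exp (2 * φ z))
    (hlog : Tendsto (fun z => φ z - γ * Real.log ‖z‖) l (𝓝 c))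
    (hbot : Tendsto (fun z => φ z + Real.log ‖z‖) l atBot) :
    Tendsto (fun z => z ^ 2 * stressEnergy φ z) l (𝓝 (-(γ * (γ + 2) / 2))) := by
  have hT' : ∀ᶠ z in l, DifferentiableAt ℂ (relStressEnergy (fun w => (γ / 2 : ℂ) / w)
      fun w => φ w - γ * Real.log ‖w‖ - c) z := by
    filter_upwards [hl0, hφ, hT] with z hz hφz hTz
    have hsq : DifferentiableAt ℂ (fun w : ℂ => (γ * (γ + 2) / 2 : ℂ) / w ^ 2) z := by
      fun_prop (disch := exact pow_ne_zero 2 hz)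
    refine (hTz.add hsq).congr_of_eventuallyEq ?_
    filter_upwards [hφz.eventually (by simp), isOpen_ne.mem_nhds hz] with w hφw hw
    exact relStressEnergy_sub_log hφw hw γ c
  have hlap : Tendsto (fun z => ‖z‖ ^ 2 *
      ‖dz (dzbar fun w => ((φ w - γ * Real.log ‖w‖ - c : ℝ) : ℂ)) z‖) l (𝓝 0) := by
    have hexp : Tendsto (fun z => ‖κ‖ * Real.exp (φ z + Real.log ‖z‖) ^ 2) l (𝓝 0) := by
      simpa using ((Real.tendsto_exp_atBot.comp hbot).pow 2).const_mul ‖κ‖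
    refine hexp.congr' ?_
    filter_upwards [hl0, hφ, hL] with z hz hφz hLz
    rw [dz_dzbar_sub_log hφz hz, hLz, norm_mul, Complex.norm_exp, Real.exp_add,
      Real.exp_log (norm_pos_iff.2 hz), mul_pow, ← Real.exp_nat_mul]
    simp only [Complex.re_mul_ofReal, Complex.re_ofNat, Nat.cast_ofNat]
    ring
  have hlim := tendsto_sq_mul_relStressEnergy hl hl0 (u := fun w => φ w - γ * Real.log ‖w‖ - c)
    (by filter_upwards [hl0, hφ] with z hz hφz using contDiffAt_sub_log hφz hz γ c) hT'
    (by simpa using hlog.sub_const c) hlap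
  have hlim' := hlim.sub_const (γ * (γ + 2) / 2 : ℂ)
  rw [zero_sub] at hlim'
  refine hlim'.congr' ?_
  filter_upwards [hl0, hφ] with z hz hφz
  rw [relStressEnergy_sub_log hφz hz]
  field_simp
  ring

lemma norm_le_three_halves_of_mem_ball (hw : w ∈ Metric.ball (1 : ℂ) (1 / 2)) : ‖w‖ ≤ 3 / 2 := by
  have hdist := norm_le_norm_add_norm_sub' w 1
  rw [Metric.mem_ball, dist_eq_norm] at hw
  rw [norm_one] at hdist
  linarith

lemma tendsto_mul_nhdsNE_zero_of_mem_ball :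
    Tendsto (fun p : ℂ × ℂ => p.1 * p.2) (𝓝[≠] 0 ×ˢ 𝓟 (Metric.ball 1 (1 / 2))) (𝓝[≠] 0) := by
  have hfst : Tendsto (fun p : ℂ × ℂ => p.1) (𝓝[≠] 0 ×ˢ 𝓟 (Metric.ball 1 (1 / 2))) (𝓝[≠] 0) :=
    tendsto_fst
  have hmem : ∀ᶠ p in 𝓝[≠] (0 : ℂ) ×ˢ 𝓟 (Metric.ball (1 : ℂ) (1 / 2)),
      p.2 ∈ Metric.ball (1 : ℂ) (1 / 2) := tendsto_snd.eventually (mem_principal_self _)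
  refine tendsto_nhdsWithin_iff.2 ⟨?_, ?_⟩
  · refine (tendsto_nhds_of_tendsto_nhdsWithin hfst).zero_mul_isBoundedUnder_le ⟨3 / 2, ?_⟩
    exact eventually_map.2 (hmem.mono fun p hp => norm_le_three_halves_of_mem_ball hp)
  · filter_upwards [hmem, hfst.eventually self_mem_nhdsWithin] with p hp hne
    exact mul_ne_zero hne (norm_pos_iff.1 (by linarith [half_le_norm_of_mem_ball hp]))

lemma tendsto_mul_cobounded_of_mem_ball :
    Tendsto (fun p : ℂ × ℂ => p.1 * p.2)
      (Bornology.cobounded ℂ ×ˢ 𝓟 (Metric.ball 1 (1 / 2))) (Bornology.cobounded ℂ) := by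
  rw [← tendsto_norm_atTop_iff_cobounded]
  refine tendsto_atTop_mono' _ ?_
    ((tendsto_norm_cobounded_atTop.comp tendsto_fst).atTop_mul_const (one_half_pos (α := ℝ)))
  filter_upwards [tendsto_snd.eventually (mem_principal_self _)] with p hp
  rw [norm_mul]
  exact mul_le_mul_of_nonneg_left (half_le_norm_of_mem_ball hp) (norm_nonneg _)

lemma dz_comp_add_right (F : ℂ → ℂ) (a z : ℂ) : dz (fun w => F (w + a)) z = dz F (z + a) := by
  rw [dz, dz, fderiv_comp_add_right]

lemma dzbar_comp_add_right (F : ℂ → ℂ) (a z : ℂ) :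
    dzbar (fun w => F (w + a)) z = dzbar F (z + a) := by
  rw [dzbar, dzbar, fderiv_comp_add_right]

lemma stressEnergy_comp_add_right (φ : ℂ → ℝ) (a z : ℂ) :
    stressEnergy (fun w => φ (w + a)) z = stressEnergy φ (z + a) := by
  have hdz : (dz fun w => (φ (w + a) : ℂ)) = fun w => dz (fun w => (φ w : ℂ)) (w + a) :=
    funext fun w => dz_comp_add_right (fun w => (φ w : ℂ)) a w
  rw [stressEnergy, stressEnergy, hdz, dz_comp_add_right]

theorem tendsto_sub_sq_mul_stressEnergy {a : ℂ} {γ c : ℝ} {κ : ℂ} (hγ : -1 < γ)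
    (hφ : ∀ᶠ z in 𝓝[≠] a, ContDiffAt ℝ 2 (fun w => (φ w : ℂ)) z)
    (hT : ∀ᶠ z in 𝓝[≠] a, DifferentiableAt ℂ (stressEnergy φ) z)
    (hL : ∀ᶠ z in 𝓝[≠] a, dz (dzbar fun w => (φ w : ℂ)) z = κ * Complex.exp (2 * φ z))
    (hlog : Tendsto (fun z => φ z - γ * Real.log ‖z - a‖) (𝓝[≠] a) (𝓝 c)) :
    Tendsto (fun z => (z - a) ^ 2 * stressEnergy φ z) (𝓝[≠] a) (𝓝 (-(γ * (γ + 2) / 2))) := by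
  have hmap : 𝓝[≠] a = map (· + a) (𝓝[≠] 0) := by simp [map_add_right_nhdsNE]
  simp only [hmap, eventually_map, tendsto_map'_iff, Function.comp_def, add_sub_cancel_right]
    at hφ hT hL hlog ⊢
  have hbot : Tendsto (fun z => φ (z + a) + Real.log ‖z‖) (𝓝[≠] 0) atBot := by
    have hlog0 : Tendsto (fun z : ℂ => Real.log ‖z‖) (𝓝[≠] 0) atBot :=
      Real.tendsto_log_nhdsGT_zero.comp tendsto_norm_nhdsNE_zero
    refine (hlog.add_atBot (hlog0.const_mul_atBot (by linarith : 0 < γ + 1))).congr fun z => ?_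
    ring
  have hlim := tendsto_sq_mul_stressEnergy (φ := fun w => φ (w + a)) (κ := κ)
    tendsto_mul_nhdsNE_zero_of_mem_ball self_mem_nhdsWithin
    (hφ.mono fun z hz => ContDiffAt.comp (g := fun w => (φ w : ℂ)) z hz
      (contDiffAt_id.add contDiffAt_const))
    (hT.mono fun z hz => ?_) (hL.mono fun z hz => ?_) hlog hbot
  · simpa only [stressEnergy_comp_add_right] using hlim
  · simp only [funext fun w => stressEnergy_comp_add_right φ a w]
    exact hz.fun_comp' z (by fun_prop)
  · have hdzbar : (dzbar fun w => (φ (w + a) : ℂ)) = fun w => dzbar (fun w => (φ w : ℂ)) (w + a) :=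
      funext fun w => dzbar_comp_add_right (fun w => (φ w : ℂ)) a w
    rw [hdzbar, dz_comp_add_right, hz]

theorem tendsto_sq_mul_stressEnergy_cobounded {γ c : ℝ} {κ : ℂ} (hγ : γ < -1)
    (hφ : ∀ᶠ z in Bornology.cobounded ℂ, ContDiffAt ℝ 2 (fun w => (φ w : ℂ)) z)
    (hT : ∀ᶠ z in Bornology.cobounded ℂ, DifferentiableAt ℂ (stressEnergy φ) z)
    (hL : ∀ᶠ z in Bornology.cobounded ℂ,
      dz (dzbar fun w => (φ w : ℂ)) z = κ * Complex.exp (2 * φ z))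
    (hlog : Tendsto (fun z => φ z - γ * Real.log ‖z‖) (Bornology.cobounded ℂ) (𝓝 c)) :
    Tendsto (fun z => z ^ 2 * stressEnergy φ z) (Bornology.cobounded ℂ)
      (𝓝 (-(γ * (γ + 2) / 2))) := by
  have hlog_top : Tendsto (fun z : ℂ => Real.log ‖z‖) (Bornology.cobounded ℂ) atTop :=
    Real.tendsto_log_atTop.comp tendsto_norm_cobounded_atTop
  refine tendsto_sq_mul_stressEnergy tendsto_mul_cobounded_of_mem_ball
    (Bornology.eventually_ne_cobounded 0) hφ hT hL hlog ?_
  refine (hlog.add_atBot (hlog_top.const_mul_atTop_of_neg (by linarith : γ + 1 < 0))).congr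
    fun z => ?_
  ring

end ConicalSingularity

/-! ### Double poles and partial fractions -/

section DoublePole

variable {T T' u : ℂ → ℂ} {a s h s' h' : ℂ}

/-- Near `a`, the function `T` equals `s / (2 (x - a)²) + h / (x - a)` up to a bounded error. The
factor `1 / 2` is that of the weight in the stress-energy tensor, and `h` is the accessory
parameter. -/
def HasDoublePole (T : ℂ → ℂ) (a s h : ℂ) : Prop :=
  (fun x => T x - (s / (2 * (x - a) ^ 2) + h / (x - a))) =O[𝓝[≠] a] fun _ => (1 : ℂ)

lemma isBigO_one_of_analyticAt (hu : AnalyticAt ℂ u a) : u =O[𝓝[≠] a] fun _ => (1 : ℂ) :=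
  hu.continuousAt.continuousWithinAt.tendsto.isBigO_one ℂ

lemma isBigO_sub_sub_deriv_mul (hu : AnalyticAt ℂ u a) :
    (fun x => u x - u a - deriv u a * (x - a)) =O[𝓝[≠] a] fun x => (x - a) ^ 2 := by
  have hslope : DifferentiableAt ℂ (dslope u a) a := by
    obtain ⟨p, hp⟩ := hu
    exact hp.has_fpower_series_dslope_fslope.differentiableAt
  refine ((hslope.isBigO_sub.mono nhdsWithin_le_nhds).mul
    (isBigO_refl (fun x => x - a) (𝓝[≠] a))).congr' ?_ (.of_forall fun x => (sq _).symm)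
  filter_upwards with x
  rw [← sub_smul_dslope u a x, dslope_same, smul_eq_mul]
  ring

lemma hasDoublePole_div_sq (hu : AnalyticAt ℂ u a) :
    HasDoublePole (fun x => u x / (x - a) ^ 2) a (2 * u a) (deriv u a) := by
  refine ((isBigO_sub_sub_deriv_mul hu).mul
    (isBigO_refl (fun x => ((x - a) ^ 2)⁻¹) (𝓝[≠] a))).congr' ?_ ?_ <;>
  filter_upwards [self_mem_nhdsWithin] with x hx <;>
  have hxa : x - a ≠ 0 := sub_ne_zero.2 hx
  · field_simp
    ring
  · field_simp

lemma HasDoublePole.congr' (hT : HasDoublePole T a s h) (hTT' : T =ᶠ[𝓝[≠] a] T') :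
    HasDoublePole T' a s h :=
  IsBigO.congr' hT (hTT'.sub .rfl) .rfl

lemma HasDoublePole.add (hT : HasDoublePole T a s h) (hT' : HasDoublePole T' a s' h') :
    HasDoublePole (fun x => T x + T' x) a (s + s') (h + h') :=
  (IsBigO.add hT hT').congr_left fun x => by ring

lemma HasDoublePole.add_isBigO_one (hT : HasDoublePole T a s h)
    (hT' : T' =O[𝓝[≠] a] fun _ => (1 : ℂ)) : HasDoublePole (fun x => T x + T' x) a s h :=
  (IsBigO.add hT hT').congr_left fun x => by ring

lemma analyticAt_doublePole {b : ℂ} (hb : b ≠ a) :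
    AnalyticAt ℂ (fun x => s / (2 * (x - a) ^ 2) + h / (x - a)) b := by
  have hba : b - a ≠ 0 := sub_ne_zero.2 hb
  fun_prop (disch := simp [hba])

theorem exists_hasDoublePole_of_tendsto (hT : ∀ᶠ z in 𝓝[≠] a, DifferentiableAt ℂ T z)
    (hlim : Tendsto (fun z => (z - a) ^ 2 * T z) (𝓝[≠] a) (𝓝 (s / 2))) :
    ∃ h, HasDoublePole T a s h := by
  set u : ℂ → ℂ := Function.update (fun z => (z - a) ^ 2 * T z) a (s / 2) with hu
  have hoff {z : ℂ} (hz : z ≠ a) : u z = (z - a) ^ 2 * T z := Function.update_of_ne hz _ _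
  have hanalytic : AnalyticAt ℂ u a := by
    refine Complex.analyticAt_of_differentiable_on_punctured_nhds_of_continuousAt ?_
      (continuousAt_update_same.2 hlim)
    filter_upwards [hT, self_mem_nhdsWithin] with z hTz hz
    have hdiff : DifferentiableAt ℂ (fun z => (z - a) ^ 2 * T z) z := by fun_prop
    refine hdiff.congr_of_eventuallyEq ?_
    filter_upwards [isOpen_ne.mem_nhds hz] with w hw using hoff hw
  have hua : 2 * u a = s := by rw [hu, Function.update_self]; ring
  refine ⟨deriv u a, hua ▸ (hasDoublePole_div_sq hanalytic).congr' ?_⟩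
  filter_upwards [self_mem_nhdsWithin] with z hz
  have hza : z - a ≠ 0 := sub_ne_zero.2 hz
  rw [hoff hz]
  field_simp

theorem exists_differentiable_eqOn_compl (S : Finset ℂ) : ∀ {D : ℂ → ℂ},
    DifferentiableOn ℂ D (↑S)ᶜ → (∀ a ∈ S, D =O[𝓝[≠] a] fun _ => (1 : ℂ)) →
    ∃ E : ℂ → ℂ, Differentiable ℂ E ∧ Set.EqOn E D (↑S)ᶜ := by
  induction S using Finset.induction_on with
  | empty => exact fun {D} hD _ => ⟨D, by simpa [differentiableOn_univ] using hD, Set.eqOn_refl _ _⟩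
  | insert a S ha ih =>
    intro D hD hbound
    have hSa : (↑(insert a S) : Set ℂ)ᶜ = (↑S)ᶜ \ {a} := by ext; simp [and_comm]
    rw [hSa] at hD ⊢
    have hext := Complex.differentiableOn_update_limUnder_of_isLittleO
      (S.finite_toSet.isClosed.isOpen_compl.mem_nhds (by simpa using ha)) hD
      (IsBoundedUnder.isLittleO_sub_self_inv ?_)
    · obtain ⟨E, hE, hEq⟩ := ih hext fun b hb => by
        have hba : b ≠ a := fun hba => ha (hba ▸ hb)
        refine (hbound b (by simp [hb])).congr' ?_ .rfl
        filter_upwards [nhdsWithin_le_nhds (isOpen_ne.mem_nhds hba)] with x hx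
        rw [Function.update_of_ne hx]
      refine ⟨E, hE, fun z hz => ?_⟩
      rw [hEq hz.1, Function.update_of_ne hz.2]
    · exact (isBigO_one_iff ℂ).1
        ((hbound a (by simp)).sub (isBigO_const_const (D a) one_ne_zero _))

theorem eq_zero_of_tendsto_cobounded {S : Finset ℂ} {D : ℂ → ℂ} (hD : DifferentiableOn ℂ D (↑S)ᶜ)
    (hbound : ∀ a ∈ S, D =O[𝓝[≠] a] fun _ => (1 : ℂ))
    (hinf : Tendsto D (Bornology.cobounded ℂ) (𝓝 0)) {x : ℂ} (hx : x ∉ S) : D x = 0 := by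
  obtain ⟨E, hE, hEq⟩ := exists_differentiable_eqOn_compl S hD hbound
  have hEinf : Tendsto E (Bornology.cobounded ℂ) (𝓝 0) := by
    refine hinf.congr' ?_
    filter_upwards [Bornology.isBounded_def.1 S.finite_toSet.isBounded] with z hz
    exact (hEq hz).symm
  rw [Metric.cobounded_eq_cocompact] at hEinf
  rw [← hEq (by simpa using hx), hE.apply_eq_of_tendsto_cocompact x hEinf]

lemma tendsto_inv_sub_cobounded (a : ℂ) :
    Tendsto (fun x => (x - a)⁻¹) (Bornology.cobounded ℂ) (𝓝 0) :=
  tendsto_inv₀_cobounded.comp (by simp [sub_eq_add_neg])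

lemma tendsto_doublePole_cobounded (a s h : ℂ) :
    Tendsto (fun x => s / (2 * (x - a) ^ 2) + h / (x - a)) (Bornology.cobounded ℂ) (𝓝 0) := by
  have hinv := tendsto_inv_sub_cobounded a
  have hsum := ((hinv.pow 2).const_mul (s / 2)).add (hinv.const_mul h)
  rw [zero_pow two_ne_zero, mul_zero, mul_zero, add_zero] at hsum
  refine hsum.congr fun x => ?_
  simp only [div_eq_mul_inv, mul_inv, inv_pow]
  ring

theorem eq_sum_of_hasDoublePole {S : Finset ℂ} {s h : ℂ → ℂ} (hT : DifferentiableOn ℂ T (↑S)ᶜ)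
    (hpole : ∀ a ∈ S, HasDoublePole T a (s a) (h a))
    (hinf : Tendsto T (Bornology.cobounded ℂ) (𝓝 0)) {x : ℂ} (hx : x ∉ S) :
    T x = ∑ a ∈ S, (s a / (2 * (x - a) ^ 2) + h a / (x - a)) := by
  rw [← sub_eq_zero]
  have hterm {a b : ℂ} (hab : b ≠ a) := analyticAt_doublePole (s := s a) (h := h a) hab
  refine eq_zero_of_tendsto_cobounded
    (D := fun x => T x - ∑ a ∈ S, (s a / (2 * (x - a) ^ 2) + h a / (x - a))) ?_ ?_ ?_ hx
  · refine hT.sub fun z hz => (DifferentiableAt.fun_sum fun a ha => ?_).differentiableWithinAt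
    exact (hterm fun hza => hz (by simpa [hza] using ha)).differentiableAt
  · intro a ha
    have hrest : AnalyticAt ℂ (fun x => ∑ b ∈ S.erase a, (s b / (2 * (x - b) ^ 2) + h b / (x - b)))
        a := Finset.analyticAt_fun_sum _ fun b hb => hterm (Finset.ne_of_mem_erase hb).symm
    refine (IsBigO.sub (hpole a ha) (isBigO_one_of_analyticAt hrest)).congr_left fun x => ?_
    rw [← Finset.add_sum_erase S _ ha, sub_sub]
  · simpa using hinf.sub (tendsto_finsetSum S fun a _ => tendsto_doublePole_cobounded a (s a) (h a))

end DoublePole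

/-! ### The stress-energy tensor of a metric with three conical singularities -/

section TriDivisor

variable (β : TriDivisor)

lemma TriDivisor.weight_zero : β.weight ((0 : ℂ) : OnePoint ℂ) = -β.b0 * (2 + β.b0) := by
  simp [TriDivisor.weight, TriDivisor.at]

lemma TriDivisor.weight_one : β.weight ((1 : ℂ) : OnePoint ℂ) = -β.b1 * (2 + β.b1) := by
  simp [TriDivisor.weight, TriDivisor.at]

lemma TriDivisor.weight_infty : β.weight ∞ = -β.binf * (2 + β.binf) := by
  simp [TriDivisor.weight, TriDivisor.at]

lemma TriDivisor.schwarzParam_zero : β.schwarzParam ((0 : ℂ) : OnePoint ℂ) =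
    (β.weight ((0 : ℂ) : OnePoint ℂ) + β.weight ((1 : ℂ) : OnePoint ℂ) - β.weight ∞) / 2 := by
  simp [TriDivisor.schwarzParam]

lemma TriDivisor.schwarzParam_one : β.schwarzParam ((1 : ℂ) : OnePoint ℂ) =
    -β.schwarzParam ((0 : ℂ) : OnePoint ℂ) := by
  simp [TriDivisor.schwarzParam]

lemma TriDivisor.schwarzParam_infty : β.schwarzParam ∞ =
    (β.weight ((1 : ℂ) : OnePoint ℂ) + β.weight ∞ - β.weight ((0 : ℂ) : OnePoint ℂ)) / 2 := by
  simp [TriDivisor.schwarzParam]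

lemma TriDivisor.at_of_notMem {p : OnePoint ℂ} (hp : p ∉ threePoints) : β.at p = 0 := by
  simp only [threePoints, Set.mem_insert_iff, Set.mem_singleton_iff, not_or] at hp
  simp only [TriDivisor.at, if_neg hp.1, if_neg hp.2.1, if_neg hp.2.2]

lemma TriDivisor.weight_of_notMem {p : OnePoint ℂ} (hp : p ∉ threePoints) : β.weight p = 0 := by
  rw [TriDivisor.weight, β.at_of_notMem hp]
  simp

lemma TriDivisor.schwarzParam_of_notMem {p : OnePoint ℂ} (hp : p ∉ threePoints) :
    β.schwarzParam p = 0 := by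
  simp only [threePoints, Set.mem_insert_iff, Set.mem_singleton_iff, not_or] at hp
  simp only [TriDivisor.schwarzParam, if_neg hp.1, if_neg hp.2.1, if_neg hp.2.2]

/-- The quadratic differential with double poles at `0`, `1`, `∞`, whose coefficients there are the
weights and Schwarz's accessory parameters. -/
def TriDivisor.tensor (z : ℂ) : ℂ :=
  (β.weight ((0 : ℂ) : OnePoint ℂ) / (2 * (z - 0) ^ 2) +
      β.schwarzParam ((0 : ℂ) : OnePoint ℂ) / (z - 0)) +
    (β.weight ((1 : ℂ) : OnePoint ℂ) / (2 * (z - 1) ^ 2) +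
      β.schwarzParam ((1 : ℂ) : OnePoint ℂ) / (z - 1))

lemma TriDivisor.analyticAt_tensor {z : ℂ} (hz : z ∈ ({0, 1}ᶜ : Set ℂ)) :
    AnalyticAt ℂ β.tensor z := by
  rw [Set.mem_compl_iff, Set.mem_insert_iff, Set.mem_singleton_iff, not_or] at hz
  exact (analyticAt_doublePole hz.1).add (analyticAt_doublePole hz.2)

lemma coe_notMem_threePoints {v : ℂ} (hv : v ∈ ({0, 1}ᶜ : Set ℂ)) :
    (v : OnePoint ℂ) ∉ threePoints := by
  simpa [threePoints] using hv

theorem TriDivisor.hasDoublePole_tensor (v : ℂ) :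
    HasDoublePole β.tensor v (β.weight (v : OnePoint ℂ)) (β.schwarzParam (v : OnePoint ℂ)) := by
  have hself (a s h : ℂ) : HasDoublePole (fun x => s / (2 * (x - a) ^ 2) + h / (x - a)) a s h := by
    simpa only [HasDoublePole, sub_self] using isBigO_zero _ _
  by_cases hv : v ∈ ({0, 1}ᶜ : Set ℂ)
  · rw [β.weight_of_notMem (coe_notMem_threePoints hv),
      β.schwarzParam_of_notMem (coe_notMem_threePoints hv)]
    simpa [HasDoublePole] using isBigO_one_of_analyticAt (β.analyticAt_tensor hv)
  rw [Set.mem_compl_iff, not_not, Set.mem_insert_iff, Set.mem_singleton_iff] at hv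
  rcases hv with rfl | rfl
  · exact (hself _ _ _).add_isBigO_one
      (isBigO_one_of_analyticAt (analyticAt_doublePole zero_ne_one))
  · have hpole := (hself 1 (β.weight ((1 : ℂ) : OnePoint ℂ))
      (β.schwarzParam ((1 : ℂ) : OnePoint ℂ))).add_isBigO_one (isBigO_one_of_analyticAt
        (analyticAt_doublePole (s := β.weight ((0 : ℂ) : OnePoint ℂ))
          (h := β.schwarzParam ((0 : ℂ) : OnePoint ℂ)) one_ne_zero))
    exact hpole.congr' (T' := β.tensor) (.of_forall fun x => add_comm _ _)

/-- The factor `w⁻⁴` is the square of the derivative of the coordinate change `z = 1 / w`. -/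
theorem TriDivisor.hasDoublePole_tensor_inv :
    HasDoublePole (fun w => β.tensor w⁻¹ * (w ^ 4)⁻¹) 0 (β.weight ∞) (β.schwarzParam ∞) := by
  set s₀ : ℂ := (β.weight ((0 : ℂ) : OnePoint ℂ) : ℂ) with hs₀
  set s₁ : ℂ := (β.weight ((1 : ℂ) : OnePoint ℂ) : ℂ) with hs₁
  set h₀ : ℂ := (β.schwarzParam ((0 : ℂ) : OnePoint ℂ) : ℂ) with hh₀
  set u : ℂ → ℂ := fun w => s₀ / 2 + s₁ / (2 * (1 - w) ^ 2) - h₀ / (1 - w) with hu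
  have hu_analytic : AnalyticAt ℂ u 0 := by
    fun_prop (disch := simp)
  have hu_zero : 2 * u 0 = β.weight ∞ := by
    simp only [hu, hs₀, hs₁, hh₀, β.schwarzParam_zero]
    push_cast
    ring
  have hu_deriv : deriv u 0 = β.schwarzParam ∞ := by
    have hsub : HasDerivAt (fun w : ℂ => 1 - w) (-1) 0 := (hasDerivAt_id 0).const_sub 1
    have hsq := (hasDerivAt_const (0 : ℂ) s₁).fun_div ((hsub.fun_pow 2).const_mul 2) (by simp)
    have hlin := (hasDerivAt_const (0 : ℂ) h₀).fun_div hsub (by simp)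
    rw [((hsq.const_add (s₀ / 2)).fun_sub hlin).deriv]
    simp only [hs₁, hh₀, β.schwarzParam_infty, β.schwarzParam_zero]
    push_cast
    ring
  have hpole := hasDoublePole_div_sq hu_analytic
  rw [hu_zero, hu_deriv] at hpole
  refine hpole.congr' ?_
  have hne : ∀ᶠ w : ℂ in 𝓝[≠] 0, w ≠ 1 := nhdsWithin_le_nhds (isOpen_ne.mem_nhds zero_ne_one)
  filter_upwards [self_mem_nhdsWithin, hne] with w hw hw1
  have hw0 : w ≠ 0 := hw
  have hw1' : 1 - w ≠ 0 := sub_ne_zero.2 hw1.symm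
  have hinv : w⁻¹ - 1 = (1 - w) / w := by field_simp
  rw [TriDivisor.tensor, hinv, β.schwarzParam_one]
  simp only [hu, sub_zero]
  push_cast
  rw [← hs₀, ← hs₁, ← hh₀]
  field_simp
  ring

end TriDivisor

lemma eq_of_tendsto_sq_mul_cobounded {s₀ s₁ h₀ h₁ L : ℂ}
    (hlim : Tendsto (fun z => z ^ 2 * ((s₀ / (2 * (z - 0) ^ 2) + h₀ / (z - 0)) +
      (s₁ / (2 * (z - 1) ^ 2) + h₁ / (z - 1)))) (Bornology.cobounded ℂ) (𝓝 (L / 2))) :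
    h₀ = (s₀ + s₁ - L) / 2 ∧ h₁ = -h₀ := by
  have hinv₀ := tendsto_inv_sub_cobounded 0
  have hinv₁ := (tendsto_inv_sub_cobounded 1).const_add 1
  have hne (a : ℂ) : ∀ᶠ z in Bornology.cobounded ℂ, z ≠ a :=
    Bornology.eventually_ne_cobounded a
  have hlin : Tendsto (fun z => (h₀ + h₁) * z) (Bornology.cobounded ℂ)
      (𝓝 (L / 2 - (s₀ / 2 + s₁ / 2 * (1 + 0) ^ 2 + h₁ * (1 + 0)))) := by
    refine (hlim.sub (((hinv₁.pow 2).const_mul (s₁ / 2)).const_add (s₀ / 2) |>.add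
      (hinv₁.const_mul h₁))).congr' ?_
    filter_upwards [hne 0, hne 1] with z hz₀ hz₁
    have := sub_ne_zero.2 hz₁
    field_simp
    ring
  have hsum : h₀ + h₁ = 0 := by
    refine tendsto_nhds_unique (tendsto_const_nhds.congr' ?_) ((hlin.mul hinv₀).trans_eq (by simp))
    filter_upwards [hne 0] with z hz
    simp [hz]
  simp only [hsum, zero_mul] at hlin
  have hzero := tendsto_nhds_unique hlin tendsto_const_nhds
  exact ⟨by linear_combination hsum + hzero, by linear_combination hsum⟩

lemma eventually_nhdsNE_mem_compl (a : ℂ) : ∀ᶠ z in 𝓝[≠] a, z ∈ ({0, 1}ᶜ : Set ℂ) := by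
  have hfin : ({0, 1} \ {a} : Set ℂ).Finite := Set.toFinite _
  filter_upwards [nhdsWithin_le_nhds (hfin.isClosed.compl_mem_nhds fun h => h.2 rfl),
    self_mem_nhdsWithin] with z hz hza hz' using hz ⟨hz', hza⟩

lemma eventually_cobounded_mem_compl : ∀ᶠ z in Bornology.cobounded ℂ, z ∈ ({0, 1}ᶜ : Set ℂ) :=
  (Set.toFinite {0, 1}).isBounded

theorem TriDivisor.eqOn_tensor (β : TriDivisor) {T : ℂ → ℂ} (hT : DifferentiableOn ℂ T {0, 1}ᶜ)
    (hzero : Tendsto (fun z => (z - 0) ^ 2 * T z) (𝓝[≠] 0)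
      (𝓝 ((β.weight ((0 : ℂ) : OnePoint ℂ) : ℂ) / 2)))
    (hone : Tendsto (fun z => (z - 1) ^ 2 * T z) (𝓝[≠] 1)
      (𝓝 ((β.weight ((1 : ℂ) : OnePoint ℂ) : ℂ) / 2)))
    (hinf : Tendsto (fun z => z ^ 2 * T z) (Bornology.cobounded ℂ) (𝓝 ((β.weight ∞ : ℂ) / 2))) :
    Set.EqOn T β.tensor {0, 1}ᶜ := by
  have hopen : IsOpen ({0, 1}ᶜ : Set ℂ) := (Set.toFinite _).isClosed.isOpen_compl
  have hT' {z : ℂ} (hz : z ∈ ({0, 1}ᶜ : Set ℂ)) : DifferentiableAt ℂ T z :=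
    hT.differentiableAt (hopen.mem_nhds hz)
  obtain ⟨h₀, hpole₀⟩ := exists_hasDoublePole_of_tendsto
    ((eventually_nhdsNE_mem_compl 0).mono fun _ => hT') hzero
  obtain ⟨h₁, hpole₁⟩ := exists_hasDoublePole_of_tendsto
    ((eventually_nhdsNE_mem_compl 1).mono fun _ => hT') hone
  have hvanish : Tendsto T (Bornology.cobounded ℂ) (𝓝 0) := by
    have hmul := hinf.mul ((tendsto_inv_sub_cobounded 0).pow 2)
    rw [zero_pow two_ne_zero, mul_zero] at hmul
    refine hmul.congr' ?_
    filter_upwards [Bornology.eventually_ne_cobounded (0 : ℂ)] with z hz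
    rw [sub_zero]
    field_simp
  have hsum : ∀ z ∈ ({0, 1}ᶜ : Set ℂ), T z =
      (β.weight ((0 : ℂ) : OnePoint ℂ) / (2 * (z - 0) ^ 2) + h₀ / (z - 0)) +
        (β.weight ((1 : ℂ) : OnePoint ℂ) / (2 * (z - 1) ^ 2) + h₁ / (z - 1)) := by
    intro z hz
    have := eq_sum_of_hasDoublePole (S := {0, 1}) (T := T) (x := z)
      (s := fun a => β.weight (a : OnePoint ℂ)) (h := fun a => if a = 0 then h₀ else h₁)
      (by simpa using hT) (by simp [hpole₀, hpole₁]) hvanish (by simpa using hz)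
    simpa using this
  obtain ⟨rfl, rfl⟩ := eq_of_tendsto_sq_mul_cobounded (hinf.congr'
    (eventually_cobounded_mem_compl.mono fun z hz => by rw [hsum z hz]))
  intro z hz
  rw [hsum z hz, TriDivisor.tensor, β.schwarzParam_one, β.schwarzParam_zero]
  push_cast
  rfl

/-- `e^{2φ} |dz|²` is a metric of constant curvature `K` on the thrice-punctured sphere, of any
area, with conical singularities of orders `β.b0`, `β.b1`, `β.binf`. Three derivatives of `φ` are
what holomorphy of its stress-energy tensor takes. -/
structure IsConicalPotential (β : TriDivisor) (K : ℝ) (φ : ℂ → ℝ) : Prop where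
  contDiffOn : ContDiffOn ℝ 3 φ {0, 1}ᶜ
  liouville : ∀ z : ℂ, z ≠ 0 → z ≠ 1 →
    (Real.exp (-2 * φ z) : ℂ) * (-4 * dz (dzbar fun w => (φ w : ℂ)) z) = (K : ℂ)
  asymp_zero : ∃ c : ℝ, Tendsto (fun z => φ z - β.b0 * Real.log ‖z‖) (𝓝[≠] (0 : ℂ)) (𝓝 c)
  asymp_one : ∃ c : ℝ, Tendsto (fun z => φ z - β.b1 * Real.log ‖z - 1‖) (𝓝[≠] (1 : ℂ)) (𝓝 c)
  asymp_infty : ∃ c : ℝ,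
    Tendsto (fun z => φ z + (β.binf + 2) * Real.log ‖z‖) (Bornology.cobounded ℂ) (𝓝 c)

section IsConicalPotential

variable {β : TriDivisor} {K : ℝ} {φ : ℂ → ℝ} {z : ℂ}

lemma IsTriPotential.isConicalPotential (hφ : IsTriPotential β φ) :
    IsConicalPotential β (2 * Real.pi * (β.degree + 2)) φ where
  contDiffOn := hφ.smooth.of_le (WithTop.coe_le_coe.2 le_top)
  liouville := hφ.liouville
  asymp_zero := hφ.asymp_zero
  asymp_one := hφ.asymp_one
  asymp_infty := hφ.asymp_infty

namespace IsConicalPotential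

lemma contDiffAt (hφ : IsConicalPotential β K φ) (hz : z ∈ ({0, 1}ᶜ : Set ℂ)) :
    ContDiffAt ℝ 3 (fun w => (φ w : ℂ)) z :=
  contDiffAt_ofReal
    (hφ.contDiffOn.contDiffAt ((Set.toFinite _).isClosed.isOpen_compl.mem_nhds hz))

lemma dz_dzbar_eq (hφ : IsConicalPotential β K φ) (hz : z ∈ ({0, 1}ᶜ : Set ℂ)) :
    dz (dzbar fun w => (φ w : ℂ)) z = -K / 4 * Complex.exp (2 * φ z) := by
  rw [Set.mem_compl_iff, Set.mem_insert_iff, Set.mem_singleton_iff, not_or] at hz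
  have hexp : Complex.exp (-2 * φ z) * Complex.exp (2 * φ z) = 1 := by
    rw [← Complex.exp_add]
    simp
  have hL := hφ.liouville z hz.1 hz.2
  push_cast at hL
  linear_combination
    -(1 / 4) * Complex.exp (2 * φ z) * hL - dz (dzbar fun w => (φ w : ℂ)) z * hexp

lemma differentiableAt_stressEnergy (hφ : IsConicalPotential β K φ)
    (hz : z ∈ ({0, 1}ᶜ : Set ℂ)) : DifferentiableAt ℂ (stressEnergy φ) z := by
  refine differentiableAt_stressEnergy_of_liouville (κ := -K / 4) (hφ.contDiffAt hz) ?_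
  filter_upwards [(Set.toFinite _).isClosed.isOpen_compl.mem_nhds hz] with w hw
  exact hφ.dz_dzbar_eq hw

theorem stressEnergy_eqOn_tensor (hφ : IsConicalPotential β K φ) (h0 : -1 < β.b0)
    (h1 : -1 < β.b1) (hinf : -1 < β.binf) : Set.EqOn (stressEnergy φ) β.tensor {0, 1}ᶜ := by
  have hC (z : ℂ) (hz : z ∈ ({0, 1}ᶜ : Set ℂ)) := (hφ.contDiffAt hz).of_le (m := 2) (by norm_num)
  have hT (z : ℂ) (hz : z ∈ ({0, 1}ᶜ : Set ℂ)) := hφ.differentiableAt_stressEnergy hz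
  have hL (z : ℂ) (hz : z ∈ ({0, 1}ᶜ : Set ℂ)) := hφ.dz_dzbar_eq hz
  have hlocal {a : ℂ} {γ c : ℝ} (hγ : -1 < γ)
      (hlog : Tendsto (fun z => φ z - γ * Real.log ‖z - a‖) (𝓝[≠] a) (𝓝 c)) :=
    have hmem := eventually_nhdsNE_mem_compl a
    tendsto_sub_sq_mul_stressEnergy hγ (hmem.mono hC) (hmem.mono hT) (hmem.mono hL) hlog
  obtain ⟨c₀, hlog₀⟩ := hφ.asymp_zero
  obtain ⟨c₁, hlog₁⟩ := hφ.asymp_one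
  obtain ⟨c, hlog⟩ := hφ.asymp_infty
  have hmem := eventually_cobounded_mem_compl
  have hlimit := tendsto_sq_mul_stressEnergy_cobounded (γ := -(β.binf + 2)) (by linarith)
    (hmem.mono hC) (hmem.mono hT) (hmem.mono hL)
    (by simpa only [neg_mul, sub_neg_eq_add] using hlog)
  refine β.eqOn_tensor (fun z hz => (hT z hz).differentiableWithinAt) ?_ ?_ ?_
  · convert hlocal (a := 0) h0 (by simpa using hlog₀) using 2
    rw [β.weight_zero]; push_cast; ring
  · convert hlocal h1 hlog₁ using 2
    rw [β.weight_one]; push_cast; ring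
  · convert hlimit using 2
    rw [β.weight_infty]; push_cast; ring

end IsConicalPotential

end IsConicalPotential

/-! ### Pulling tensors back along holomorphic maps -/

section Pullback

variable {τ f g h : ℂ → ℂ} {x : ℂ}

lemma schwarzian_congr (hfg : f =ᶠ[𝓝 x] g) : schwarzian f x = schwarzian g x := by
  have hlog : logDeriv (deriv f) =ᶠ[𝓝 x] logDeriv (deriv g) :=
    hfg.deriv.deriv.div hfg.deriv
  rw [schwarzian, schwarzian, hlog.self_of_nhds, hlog.deriv_eq]

lemma pullTensor_congr (hfg : f =ᶠ[𝓝 x] g) : pullTensor τ f x = pullTensor τ g x := by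
  rw [pullTensor, pullTensor, schwarzian_congr hfg, hfg.self_of_nhds, hfg.deriv_eq]

lemma pullTensor_sub_const (τ f : ℂ → ℂ) (v x : ℂ) :
    pullTensor (fun w => τ (w + v)) (fun x => f x - v) x = pullTensor τ f x := by
  simp [pullTensor, schwarzian, deriv_sub_const_fun]

lemma logDeriv_deriv_comp (hf : AnalyticAt ℂ f (h x)) (hh : AnalyticAt ℂ h x)
    (hf' : deriv f (h x) ≠ 0) (hh' : deriv h x ≠ 0) :
    logDeriv (deriv fun x => f (h x)) x =
      logDeriv (deriv f) (h x) * deriv h x + logDeriv (deriv h) x := by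
  have hderiv : deriv (fun x => f (h x)) =ᶠ[𝓝 x] fun y => deriv f (h y) * deriv h y := by
    filter_upwards [hh.continuousAt.eventually hf.eventually_analyticAt,
      hh.eventually_analyticAt] with y hfy hhy
    exact deriv_comp y hfy.differentiableAt hhy.differentiableAt
  have hcomp : logDeriv (fun y => deriv f (h y)) x = logDeriv (deriv f) (h x) * deriv h x :=
    logDeriv_comp hf.deriv.differentiableAt hh.differentiableAt
  rw [(logDeriv_congr_nhds hderiv).self_of_nhds,
    logDeriv_mul (f := fun y => deriv f (h y)) x hf' hh'
      (hf.deriv.differentiableAt.fun_comp' x hh.differentiableAt) hh.deriv.differentiableAt, hcomp]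

theorem schwarzian_comp (hf : AnalyticAt ℂ f (h x)) (hh : AnalyticAt ℂ h x)
    (hf' : deriv f (h x) ≠ 0) (hh' : deriv h x ≠ 0) :
    schwarzian (fun x => f (h x)) x = schwarzian f (h x) * deriv h x ^ 2 + schwarzian h x := by
  have hlog : logDeriv (deriv fun x => f (h x)) =ᶠ[𝓝 x]
      fun y => logDeriv (deriv f) (h y) * deriv h y + logDeriv (deriv h) y := by
    filter_upwards [hh.continuousAt.eventually hf.eventually_analyticAt,
      hh.eventually_analyticAt, hh.deriv.continuousAt.eventually_ne hh',
      (hf.deriv.continuousAt.comp hh.continuousAt).eventually_ne hf'] with y hfy hhy hhy' hfy'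
    exact logDeriv_deriv_comp hfy hhy hfy' hhy'
  have hcomp : HasDerivAt (fun y => logDeriv (deriv f) (h y))
      (deriv (logDeriv (deriv f)) (h x) * deriv h x) x :=
    (analyticAt_logDeriv hf.deriv hf').differentiableAt.hasDerivAt.comp x
      hh.differentiableAt.hasDerivAt
  have hderiv := (hcomp.fun_mul hh.deriv.differentiableAt.hasDerivAt).fun_add
    (analyticAt_logDeriv hh.deriv hh').differentiableAt.hasDerivAt
  have hh'' : deriv (deriv h) x = logDeriv (deriv h) x * deriv h x := by
    rw [logDeriv_apply]
    field_simp
  rw [schwarzian, hlog.self_of_nhds, hlog.deriv_eq, schwarzian, schwarzian, hderiv.deriv, hh'']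
  ring

lemma schwarzian_inv (hx : x ≠ 0) : schwarzian (fun z => z⁻¹) x = 0 := by
  have hlog : logDeriv (deriv fun z : ℂ => z⁻¹) =ᶠ[𝓝 x] fun z => -2 * z⁻¹ := by
    filter_upwards [isOpen_ne.mem_nhds hx] with z hz
    rw [deriv_inv', logDeriv_apply,
      ((hasDerivAt_pow 2 z).fun_inv (pow_ne_zero 2 hz)).fun_neg.deriv]
    simp only [Nat.cast_ofNat, Nat.add_one_sub_one, pow_one]
    field_simp
  rw [schwarzian, hlog.self_of_nhds, hlog.deriv_eq, deriv_const_mul_field, deriv_inv]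
  field_simp
  ring

lemma pullTensor_inv (hf : AnalyticAt ℂ f x) (hfx : f x ≠ 0) (hf' : deriv f x ≠ 0) :
    pullTensor (fun w => τ w⁻¹ * (w ^ 4)⁻¹) (fun x => (f x)⁻¹) x = pullTensor τ f x := by
  have hinv' : deriv (fun z : ℂ => z⁻¹) (f x) ≠ 0 := by simpa [deriv_inv] using hfx
  rw [pullTensor, schwarzian_comp (f := fun z => z⁻¹) (analyticAt_inv hfx) hf hinv' hf',
    schwarzian_inv hfx, deriv_fun_inv'' hf.differentiableAt hfx, pullTensor, inv_inv]
  field_simp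
  ring

lemma pullTensor_comp_inv (hx : x ≠ 0) (hf : AnalyticAt ℂ f x⁻¹) (hf' : deriv f x⁻¹ ≠ 0) :
    pullTensor τ (fun t => f t⁻¹) x = pullTensor τ f x⁻¹ * (x ^ 4)⁻¹ := by
  have hinv' : deriv (fun z : ℂ => z⁻¹) x ≠ 0 := by simpa [deriv_inv] using hx
  have hderiv : deriv (fun t => f t⁻¹) x = deriv f x⁻¹ * deriv (fun z => z⁻¹) x :=
    deriv_comp x hf.differentiableAt (differentiableAt_inv hx)
  rw [pullTensor, schwarzian_comp (h := fun z => z⁻¹) hf (analyticAt_inv hx) hf' hinv',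
    schwarzian_inv hx, hderiv, pullTensor, deriv_inv]
  field_simp
  ring

end Pullback

/-! ### The pullback of a double pole at a ramification point -/

section Ramification

variable {τ y g k : ℂ → ℂ} {a s h : ℂ} {N : ℕ}

lemma logDeriv_pow_mul {x : ℂ} (hx : x ≠ a) (hg : AnalyticAt ℂ g x) (hgx : g x ≠ 0) :
    logDeriv (fun x => (x - a) ^ N * g x) x = N / (x - a) + logDeriv g x := by
  have hxa : x - a ≠ 0 := sub_ne_zero.2 hx
  rw [logDeriv_mul (f := fun x => (x - a) ^ N) x (pow_ne_zero N hxa) hgx (by fun_prop)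
    hg.differentiableAt, logDeriv_fun_pow (by fun_prop)]
  simp [logDeriv_apply, div_eq_mul_inv]

lemma hasDoublePole_schwarzian_of_logDeriv {m : ℂ → ℂ} {n : ℂ}
    (hy : ∀ᶠ x in 𝓝[≠] a, logDeriv (deriv y) x = n / (x - a) + m x) (hm : AnalyticAt ℂ m a) :
    HasDoublePole (schwarzian y) a (-(n * (n + 2))) (-(n * m a)) := by
  set u : ℂ → ℂ := fun x => -n - n ^ 2 / 2 - n * m x * (x - a) +
    (deriv m x - m x ^ 2 / 2) * (x - a) ^ 2 with hu
  have hu_an : AnalyticAt ℂ u a := by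
    have := hm.deriv
    fun_prop
  have hu' : deriv u a = -(n * m a) := by
    have hsub : HasDerivAt (fun x => x - a) 1 a := (hasDerivAt_id a).sub_const a
    have hlin := (hm.differentiableAt.hasDerivAt.const_mul n).fun_mul hsub
    have hquad := ((hm.deriv.fun_sub ((hm.fun_pow 2).fun_div
      analyticAt_const two_ne_zero)).differentiableAt.hasDerivAt).fun_mul (hsub.fun_pow 2)
    rw [((hlin.const_sub (-n - n ^ 2 / 2)).fun_add hquad).deriv]
    simp
  convert (hasDoublePole_div_sq hu_an).congr' (T' := schwarzian y) ?_ using 1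
  · simp only [hu, sub_self]
    ring
  · exact hu'.symm
  filter_upwards [eventually_eventually_nhdsWithin.2 hy, hy, self_mem_nhdsWithin,
    nhdsWithin_le_nhds hm.eventually_analyticAt] with x hyx hx_eq hx hmx
  rw [isOpen_compl_singleton.nhdsWithin_eq hx] at hyx
  have hxa : x - a ≠ 0 := sub_ne_zero.2 hx
  have hderiv := ((hasDerivAt_const x n).fun_div ((hasDerivAt_id' x).sub_const a) hxa).fun_add
    hmx.differentiableAt.hasDerivAt
  rw [schwarzian, hx_eq, EventuallyEq.deriv_eq hyx, hderiv.deriv]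
  simp only [hu]
  field_simp
  ring

theorem hasDoublePole_schwarzian (hy : ∀ᶠ x in 𝓝[≠] a, deriv y x = (x - a) ^ N * k x)
    (hk : AnalyticAt ℂ k a) (hka : k a ≠ 0) :
    HasDoublePole (schwarzian y) a (-(N * (N + 2))) (-(N * logDeriv k a)) := by
  refine hasDoublePole_schwarzian_of_logDeriv ?_ (analyticAt_logDeriv hk hka)
  filter_upwards [eventually_eventually_nhdsWithin.2 hy, self_mem_nhdsWithin,
    nhdsWithin_le_nhds hk.eventually_analyticAt,
    nhdsWithin_le_nhds (hk.continuousAt.eventually_ne hka)] with x hyx hx hkx hkx'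
  rw [isOpen_compl_singleton.nhdsWithin_eq hx] at hyx
  rw [(logDeriv_congr_nhds hyx).self_of_nhds, logDeriv_pow_mul hx hkx hkx']

lemma hasDerivAt_pow_mul_self (hN : N ≠ 0) (hg : AnalyticAt ℂ g a) :
    HasDerivAt (fun x => (x - a) ^ N * g x) (if N = 1 then g a else 0) a := by
  refine ((((hasDerivAt_id' a).sub_const a).fun_pow N).fun_mul
    hg.differentiableAt.hasDerivAt).congr_deriv ?_
  split_ifs with hN1
  · simp [hN1]
  · simp [hN, Nat.sub_ne_zero_of_lt (by omega : 1 < N)]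

lemma tendsto_pow_mul_nhdsNE (hN : N ≠ 0) (hg : AnalyticAt ℂ g a) (hga : g a ≠ 0) :
    Tendsto (fun x => (x - a) ^ N * g x) (𝓝[≠] a) (𝓝[≠] 0) := by
  refine tendsto_nhdsWithin_iff.2 ⟨?_, ?_⟩
  · convert (hasDerivAt_pow_mul_self hN hg).continuousAt.tendsto.mono_left nhdsWithin_le_nhds
    simp [hN]
  · filter_upwards [self_mem_nhdsWithin, nhdsWithin_le_nhds (hg.continuousAt.eventually_ne hga)]
      with x hx hgx using mul_ne_zero (pow_ne_zero _ (sub_ne_zero.2 hx)) hgx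

theorem HasDoublePole.comp_mul_deriv_sq {ℓ : ℂ → ℂ} {n : ℂ} (hτ : HasDoublePole τ 0 s h)
    (hy : AnalyticAt ℂ y a) (hy_tendsto : Tendsto y (𝓝[≠] a) (𝓝[≠] 0)) (hℓ : AnalyticAt ℂ ℓ a)
    (hy' : ∀ᶠ x in 𝓝[≠] a, deriv y x = y x * (n / (x - a) + ℓ x)) :
    HasDoublePole (fun x => τ (y x) * deriv y x ^ 2) a (n ^ 2 * s)
      (n * s * ℓ a + n ^ 2 * h * deriv y a) := by
  have hya : y a = 0 := tendsto_nhds_unique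
    (hy.continuousAt.tendsto.mono_left nhdsWithin_le_nhds)
    (hy_tendsto.mono_right nhdsWithin_le_nhds)
  have hbdd : (fun x => (τ (y x) - (s / (2 * (y x - 0) ^ 2) + h / (y x - 0))) * deriv y x ^ 2)
      =O[𝓝[≠] a] fun _ => (1 : ℂ) :=
    ((hτ.comp_tendsto hy_tendsto).mul
      (isBigO_one_of_analyticAt (hy.deriv.fun_pow 2))).congr_right fun _ => mul_one 1
  set u : ℂ → ℂ := fun x => (s / 2 + h * y x) * (n + (x - a) * ℓ x) ^ 2 with hu
  have hu_an : AnalyticAt ℂ u a := by fun_prop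
  have hu' : deriv u a = n * s * ℓ a + n ^ 2 * h * deriv y a := by
    have hlin := (((hasDerivAt_id' a).sub_const a).fun_mul
      hℓ.differentiableAt.hasDerivAt).const_add n
    rw [(((hy.differentiableAt.hasDerivAt.const_mul h).const_add (s / 2)).fun_mul
      (hlin.fun_pow 2)).deriv, hya]
    simp only [one_mul, zero_mul, add_zero, sub_self, mul_zero, Nat.cast_ofNat]
    ring
  convert ((hasDoublePole_div_sq hu_an).add_isBigO_one hbdd).congr' ?_ using 1
  · simp only [hu, hya, sub_self]
    ring
  · exact hu'.symm
  filter_upwards [self_mem_nhdsWithin, hy', hy_tendsto self_mem_nhdsWithin] with x hx hx' hyx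
  have hxa : x - a ≠ 0 := sub_ne_zero.2 hx
  have hyx' : y x ≠ 0 := hyx
  simp only [hu, hx', sub_zero]
  field_simp
  ring

lemma HasDoublePole.comp_pow_mul (hτ : HasDoublePole τ 0 s h) (hN : N ≠ 0)
    (hg : AnalyticAt ℂ g a) (hga : g a ≠ 0) (hy : y = fun x => (x - a) ^ N * g x) :
    HasDoublePole (fun x => τ (y x) * deriv y x ^ 2) a (N ^ 2 * s)
      (N * s * logDeriv g a + N ^ 2 * h * if N = 1 then g a else 0) := by
  subst hy
  rw [← (hasDerivAt_pow_mul_self hN hg).deriv]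
  refine hτ.comp_mul_deriv_sq (by fun_prop) (tendsto_pow_mul_nhdsNE hN hg hga)
    (analyticAt_logDeriv hg hga) ?_
  filter_upwards [self_mem_nhdsWithin, nhdsWithin_le_nhds hg.eventually_analyticAt,
    nhdsWithin_le_nhds (hg.continuousAt.eventually_ne hga)] with x hx hgx hgx'
  rw [← logDeriv_pow_mul hx hgx hgx', logDeriv_apply,
    mul_div_cancel₀ _ (mul_ne_zero (pow_ne_zero N (sub_ne_zero.2 hx)) hgx')]

/-- The accessory parameter, at a zero `c t ^ N (1 + (d / c) t + ⋯)` of a map, of the pullback of a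
tensor with the double pole `s / (2 w²) + h / w` at `w = 0`. -/
def pullAccessory (N : ℕ) (c d s h : ℂ) : ℂ :=
  d / c * ((N ^ 2 * s + 1 - N ^ 2) / N) + if N = 1 then c * h else 0

lemma pullAccessory_one (c d s h : ℂ) : pullAccessory 1 c d s h = d / c * s + c * h := by
  simp [pullAccessory]

lemma pullAccessory_of_ne_one (hN : N ≠ 1) (c d s h : ℂ) :
    pullAccessory N c d s h = d / c * ((N ^ 2 * s + 1 - N ^ 2) / N) := by
  simp [pullAccessory, hN]

lemma deriv_pow_succ_mul {M : ℕ} {x : ℂ} (hg : AnalyticAt ℂ g x) :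
    deriv (fun x => (x - a) ^ (M + 1) * g x) x =
      (x - a) ^ M * ((M + 1) * g x + (x - a) * deriv g x) := by
  rw [((((hasDerivAt_id' x).sub_const a).fun_pow (M + 1)).fun_mul
    hg.differentiableAt.hasDerivAt).deriv]
  push_cast
  ring

lemma logDeriv_mul_add_mul_deriv (n : ℂ) (hg : AnalyticAt ℂ g a) :
    logDeriv (fun x => n * g x + (x - a) * deriv g x) a = (n + 1) / n * logDeriv g a := by
  rw [logDeriv_apply, logDeriv_apply, ((hg.differentiableAt.hasDerivAt.const_mul n).fun_add
    (((hasDerivAt_id' a).sub_const a).fun_mul hg.deriv.differentiableAt.hasDerivAt)).deriv,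
    div_mul_div_comm]
  congr 1 <;> ring

theorem HasDoublePole.pullTensor (hτ : HasDoublePole τ 0 s h) (hN : N ≠ 0)
    (hg : AnalyticAt ℂ g a) (hga : g a ≠ 0) (hy : ∀ᶠ x in 𝓝[≠] a, y x = (x - a) ^ N * g x) :
    HasDoublePole (pullTensor τ y) a (N ^ 2 * s + 1 - N ^ 2)
      (pullAccessory N (g a) (deriv g a) s h) := by
  obtain ⟨M, rfl⟩ := Nat.exists_eq_succ_of_ne_zero hN
  have hM : (M + 1 : ℂ) ≠ 0 := by exact_mod_cast hN
  set Y : ℂ → ℂ := fun x => (x - a) ^ (M + 1) * g x with hY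
  have hschwarzian := hasDoublePole_schwarzian (y := Y)
    (nhdsWithin_le_nhds (hg.eventually_analyticAt.mono fun x hx => deriv_pow_succ_mul hx))
    ((analyticAt_const.mul hg).fun_add ((analyticAt_id.fun_sub analyticAt_const).fun_mul hg.deriv))
    (by simpa using ⟨hM, hga⟩)
  rw [logDeriv_mul_add_mul_deriv _ hg] at hschwarzian
  convert ((hτ.comp_pow_mul hN hg hga hY).add hschwarzian).congr'
    (T' := ConicalSphere.pullTensor τ y) ?_ using 1
  · push_cast
    ring
  · rw [pullAccessory, logDeriv_apply]
    split_ifs with hM1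
    · obtain rfl : M = 0 := by omega
      simp only [zero_add, Nat.cast_one, Nat.cast_zero, one_pow, one_mul]
      ring
    · push_cast
      field_simp
      ring
  filter_upwards [eventually_eventually_nhdsWithin.2 hy, self_mem_nhdsWithin] with x hyx hx
  rw [isOpen_compl_singleton.nhdsWithin_eq hx] at hyx
  exact (pullTensor_congr hyx).symm

theorem HasDoublePole.pullTensor_inv (hτ : HasDoublePole (fun w => τ w⁻¹ * (w ^ 4)⁻¹) 0 s h)
    (hN : N ≠ 0) (hg : AnalyticAt ℂ g a) (hga : g a ≠ 0)
    (hy : ∀ᶠ x in 𝓝[≠] a, y x = ((x - a) ^ N)⁻¹ * g x)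
    (hy_an : ∀ᶠ x in 𝓝[≠] a, AnalyticAt ℂ y x ∧ deriv y x ≠ 0) :
    HasDoublePole (ConicalSphere.pullTensor τ y) a (N ^ 2 * s + 1 - N ^ 2)
      (pullAccessory N (g a)⁻¹ (-deriv g a / g a ^ 2) s h) := by
  rw [← deriv_fun_inv'' hg.differentiableAt hga]
  refine (hτ.pullTensor (y := fun x => (y x)⁻¹) hN (hg.fun_inv hga) (inv_ne_zero hga) ?_).congr' ?_
  · filter_upwards [hy] with x hx
    rw [hx, mul_inv, inv_inv]
  · filter_upwards [hy, hy_an, self_mem_nhdsWithin,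
      nhdsWithin_le_nhds (hg.continuousAt.eventually_ne hga)] with x hx ⟨hyx, hyx'⟩ hxa hgx
    refine ConicalSphere.pullTensor_inv hyx ?_ hyx'
    rw [hx]
    exact mul_ne_zero (inv_ne_zero (pow_ne_zero N (sub_ne_zero.2 hxa))) hgx

lemma HasDoublePole.comp_add_const {T : ℂ → ℂ} {v : ℂ} (hT : HasDoublePole T v s h) :
    HasDoublePole (fun w => T (w + v)) 0 s h := by
  have htendsto : Tendsto (fun w => w + v) (𝓝[≠] 0) (𝓝[≠] v) := by
    refine tendsto_nhdsWithin_iff.2 ⟨?_, ?_⟩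
    · exact ((continuous_add_const v).tendsto' 0 v (zero_add v)).mono_left nhdsWithin_le_nhds
    · filter_upwards [self_mem_nhdsWithin] with w hw
      simpa using hw
  refine (hT.comp_tendsto htendsto).congr_left fun w => ?_
  simp

theorem HasDoublePole.pullTensor_of_sub {v : ℂ} (hτ : HasDoublePole τ v s h) (hN : N ≠ 0)
    (hg : AnalyticAt ℂ g a) (hga : g a ≠ 0)
    (hy : ∀ᶠ x in 𝓝[≠] a, y x - v = (x - a) ^ N * g x) :
    HasDoublePole (ConicalSphere.pullTensor τ y) a (N ^ 2 * s + 1 - N ^ 2)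
      (pullAccessory N (g a) (deriv g a) s h) :=
  (hτ.comp_add_const.pullTensor hN hg hga hy).congr'
    (.of_forall fun x => pullTensor_sub_const τ y v x)

end Ramification

/-! ### Uniqueness of Taylor coefficients -/

section Taylor

variable {g : ℂ → ℂ} {a : ℂ}

lemma eq_zero_of_isBigO_sub_sq {p q : ℂ}
    (hpq : (fun x => p + q * (x - a)) =O[𝓝[≠] a] fun x => (x - a) ^ 2) : p = 0 ∧ q = 0 := by
  have hsub : Tendsto (fun x => x - a) (𝓝[≠] a) (𝓝 0) :=
    ((continuous_sub_right a).tendsto' a 0 (sub_self a)).mono_left nhdsWithin_le_nhds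
  obtain rfl : p = 0 := by
    have hlim : Tendsto (fun x => p + q * (x - a)) (𝓝[≠] a) (𝓝 p) := by
      simpa using (hsub.const_mul q).const_add p
    exact tendsto_nhds_unique hlim (hpq.trans_tendsto (by simpa using hsub.pow 2))
  have hq : (fun _ => q) =O[𝓝[≠] a] fun x => x - a := by
    refine (hpq.mul (isBigO_refl (fun x => (x - a)⁻¹) (𝓝[≠] a))).congr' ?_ ?_ <;>
    filter_upwards [self_mem_nhdsWithin] with x hx <;>
    have hxa : x - a ≠ 0 := sub_ne_zero.2 hx <;>
    field_simp
    ring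
  exact ⟨rfl, tendsto_nhds_unique tendsto_const_nhds (hq.trans_tendsto hsub)⟩

lemma isBigO_taylor_iff (hg : AnalyticAt ℂ g a) {c d : ℂ} :
    (fun x => g x - c - d * (x - a)) =O[𝓝[≠] a] (fun x => (x - a) ^ 2) ↔
      c = g a ∧ d = deriv g a := by
  refine ⟨fun hcd => ?_, ?_⟩
  · obtain ⟨hc, hd⟩ := eq_zero_of_isBigO_sub_sq (a := a) (p := g a - c) (q := deriv g a - d)
      ((hcd.sub (isBigO_sub_sub_deriv_mul hg)).congr_left fun x => by ring)
    exact ⟨(sub_eq_zero.1 hc).symm, (sub_eq_zero.1 hd).symm⟩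
  · rintro ⟨rfl, rfl⟩
    exact isBigO_sub_sub_deriv_mul hg

lemma isBigO_zpow_mul_left_iff (m : ℤ) {u v : ℂ → ℂ} :
    (fun x => (x - a) ^ m * u x) =O[𝓝[≠] a] (fun x => (x - a) ^ m * v x) ↔ u =O[𝓝[≠] a] v := by
  refine ⟨fun huv => ?_, (isBigO_refl _ _).mul⟩
  refine ((isBigO_refl (fun x => (x - a) ^ (-m)) (𝓝[≠] a)).mul huv).congr' ?_ ?_ <;>
  filter_upwards [self_mem_nhdsWithin] with x hx <;>
  rw [← mul_assoc, ← zpow_add₀ (sub_ne_zero.2 hx), neg_add_cancel, zpow_zero, one_mul]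

theorem isBigO_sub_zpow_mul_taylor_iff {y : ℂ → ℂ} {m : ℤ} (hg : AnalyticAt ℂ g a)
    (hga : g a ≠ 0) (hy : ∀ᶠ x in 𝓝[≠] a, y x = (x - a) ^ m * g x) {c d : ℂ} :
    (c ≠ 0 ∧ (fun x => y x - c * (x - a) ^ m * (1 + d / c * (x - a))) =O[𝓝[≠] a]
      fun x => (x - a) ^ (m + 2)) ↔ c = g a ∧ d = deriv g a := by
  have key (hc : c ≠ 0) : (fun x => y x - c * (x - a) ^ m * (1 + d / c * (x - a))) =O[𝓝[≠] a]
      (fun x => (x - a) ^ (m + 2)) ↔ c = g a ∧ d = deriv g a := by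
    rw [← isBigO_taylor_iff hg, ← isBigO_zpow_mul_left_iff m
      (u := fun x => g x - c - d * (x - a))]
    refine isBigO_congr ?_ ?_
    · filter_upwards [hy] with x hx
      rw [hx]
      field_simp
      ring
    · filter_upwards [self_mem_nhdsWithin] with x hx
      rw [zpow_add₀ (sub_ne_zero.2 hx)]
      norm_cast
  exact ⟨fun h => (key h.1).1 h.2, fun h => ⟨h.1 ▸ hga, (key (h.1 ▸ hga)).2 h⟩⟩

end Taylor

/-! ### Wronskians of polynomials -/

section Wronskian

variable {A B : ℂ[X]} {a : ℂ}

lemma coeff_X_mul_derivative (A : ℂ[X]) (n : ℕ) : (X * derivative A).coeff n = n * A.coeff n := by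
  cases n with
  | zero => simp
  | succ n =>
    rw [coeff_X_mul, coeff_derivative]
    push_cast
    ring

lemma natDegree_X_mul_derivative_le (A : ℂ[X]) : (X * derivative A).natDegree ≤ A.natDegree :=
  natDegree_le_iff_coeff_eq_zero.2 fun n hn => by
    rw [coeff_X_mul_derivative, coeff_eq_zero_of_natDegree_lt hn, mul_zero]

theorem natDegree_wronskian_add_one (hA : A ≠ 0) (hB : B ≠ 0) (hAB : A.natDegree ≠ B.natDegree) :
    (wronskian A B).natDegree + 1 = A.natDegree + B.natDegree := by
  have hXW : X * wronskian A B = A * (X * derivative B) - X * derivative A * B := by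
    rw [wronskian]
    ring
  have hcoeff : (X * wronskian A B).coeff (A.natDegree + B.natDegree) ≠ 0 := by
    have hval : (X * wronskian A B).coeff (A.natDegree + B.natDegree) =
        (B.natDegree - A.natDegree) * (A.leadingCoeff * B.leadingCoeff) := by
      rw [hXW, coeff_sub, coeff_mul_add_eq_of_natDegree_le le_rfl (natDegree_X_mul_derivative_le B),
        coeff_mul_add_eq_of_natDegree_le (natDegree_X_mul_derivative_le A) le_rfl,
        coeff_X_mul_derivative, coeff_X_mul_derivative, leadingCoeff, leadingCoeff]
      ring
    rw [hval]
    exact mul_ne_zero (sub_ne_zero.2 (by exact_mod_cast hAB.symm))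
      (mul_ne_zero (leadingCoeff_ne_zero.2 hA) (leadingCoeff_ne_zero.2 hB))
  have hW : wronskian A B ≠ 0 := by
    intro hW
    simp [hW] at hcoeff
  rw [← natDegree_X_mul hW]
  refine natDegree_eq_of_le_of_coeff_ne_zero ?_ hcoeff
  rw [hXW]
  exact (natDegree_sub_le _ _).trans <| max_le
    (natDegree_mul_le.trans (Nat.add_le_add_left (natDegree_X_mul_derivative_le B) _))
    (natDegree_mul_le.trans (Nat.add_le_add_right (natDegree_X_mul_derivative_le A) _))

theorem rootMultiplicity_wronskian_add_one (hW : wronskian A B ≠ 0) (hA : A.IsRoot a)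
    (hB : ¬B.IsRoot a) : (wronskian A B).rootMultiplicity a + 1 = A.rootMultiplicity a := by
  have hA0 : A ≠ 0 := by
    rintro rfl
    simp at hW
  have hpos := (rootMultiplicity_pos hA0).2 hA
  have hderiv := derivative_rootMultiplicity_of_root hA
  set n := A.rootMultiplicity a
  have hAB' : (X - C a) ^ n ∣ A * derivative B := (pow_rootMultiplicity_dvd A a).mul_right _
  have hcop : IsCoprime ((X - C a) ^ n) B :=
    IsCoprime.pow_left ((irreducible_X_sub_C a).coprime_iff_not_dvd.2 (mt dvd_iff_isRoot.1 hB))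
  have hA'0 : derivative A ≠ 0 := by
    intro hA'
    obtain ⟨c, rfl⟩ := natDegree_eq_zero.1 (derivative_eq_zero.1 hA')
    simp_all
  have hlow : n - 1 ≤ (wronskian A B).rootMultiplicity a :=
    (le_rootMultiplicity_iff hW).2 (((pow_dvd_pow _ (n.sub_le 1)).trans hAB').sub
      ((hderiv ▸ pow_rootMultiplicity_dvd (derivative A) a).mul_right B))
  have hupp : ¬n ≤ (wronskian A B).rootMultiplicity a := by
    rw [le_rootMultiplicity_iff hW, wronskian, dvd_sub_right hAB']
    intro hdvd
    have := (le_rootMultiplicity_iff hA'0).2 (hcop.dvd_of_dvd_mul_right hdvd)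
    omega
  omega

lemma rootMultiplicity_neg (A : ℂ[X]) (a : ℂ) :
    (-A).rootMultiplicity a = A.rootMultiplicity a := by
  rw [← count_roots, ← count_roots, roots_neg]

end Wronskian

/-! ### Fibres and multiplicities of rational functions -/

section Fibre

variable {f : RatFunc ℂ} {a : ℂ} {p v w : OnePoint ℂ}

/-- The polynomial whose roots are the finite points of the fibre `f⁻¹(v)` of a rational function
`f = P / Q`, with their multiplicities: `P - v Q` if `v` is finite, and `Q` if `v = ∞`. -/
def fibrePoly (f : RatFunc ℂ) : OnePoint ℂ → ℂ[X]
  | ∞ => f.denom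
  | (v : ℂ) => f.num - C v * f.denom

lemma fibrePoly_infty (f : RatFunc ℂ) : fibrePoly f ∞ = f.denom := rfl

lemma fibrePoly_coe (f : RatFunc ℂ) (v : ℂ) : fibrePoly f v = f.num - C v * f.denom := rfl

lemma fibrePoly_zero (f : RatFunc ℂ) : fibrePoly f (0 : ℂ) = f.num := by simp [fibrePoly_coe]

lemma fibrePoly_ne_zero (hf : 1 ≤ ratDegree f) (v : OnePoint ℂ) : fibrePoly f v ≠ 0 := by
  induction v using OnePoint.rec with
  | infty => exact f.denom_ne_zero
  | coe v =>
    intro hv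
    rw [fibrePoly_coe, sub_eq_zero] at hv
    have hunit : IsUnit f.denom :=
      f.isCoprime_num_denom.isUnit_of_dvd' (hv ▸ dvd_mul_left _ _) dvd_rfl
    rw [ratDegree, hv, f.monic_denom.eq_one_of_isUnit hunit] at hf
    simp at hf

lemma natDegree_fibrePoly_le (f : RatFunc ℂ) (v : OnePoint ℂ) :
    (fibrePoly f v).natDegree ≤ ratDegree f := by
  induction v using OnePoint.rec with
  | infty => exact le_max_right _ _
  | coe v => exact (natDegree_sub_le _ _).trans (max_le_max le_rfl (natDegree_C_mul_le _ _))

lemma eval_num_ne_zero (ha : f.denom.eval a = 0) : f.num.eval a ≠ 0 := by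
  intro ha'
  obtain ⟨u, v, huv⟩ := f.isCoprime_num_denom
  simpa [ha, ha'] using congrArg (eval a) huv

lemma sphereMap_coe_eq_iff : sphereMap f a = v ↔ (fibrePoly f v).IsRoot a := by
  have hsphere : sphereMap f a =
      if f.denom.eval a = 0 then ∞ else ((ratFun f a : ℂ) : OnePoint ℂ) := rfl
  rw [hsphere, IsRoot]
  induction v using OnePoint.rec with
  | infty => split_ifs with ha <;> simp [fibrePoly_infty, ha]
  | coe v =>
    split_ifs with ha
    · simp [fibrePoly_coe, ha, eval_num_ne_zero ha]
    · rw [OnePoint.coe_eq_coe, ratFun, RatFunc.eval, eval₂_id, eval₂_id, div_eq_iff ha]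
      simp [fibrePoly_coe, sub_eq_zero]

lemma sphereMap_infty_eq_iff (hf : 1 ≤ ratDegree f) :
    sphereMap f ∞ = v ↔ (fibrePoly f v).natDegree < ratDegree f := by
  have hsphere : sphereMap f ∞ = if f.denom.natDegree < f.num.natDegree then ∞
      else ((f.num.coeff f.denom.natDegree / f.denom.leadingCoeff : ℂ) : OnePoint ℂ) := rfl
  rw [hsphere, f.monic_denom.leadingCoeff, div_one]
  induction v using OnePoint.rec with
  | infty => split_ifs with hdeg <;> simp [fibrePoly_infty, ratDegree, hdeg]
  | coe v =>
    split_ifs with hdeg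
    · have hlt : (C v * f.denom).natDegree < f.num.natDegree :=
        (natDegree_C_mul_le _ _).trans_lt hdeg
      simp [fibrePoly_coe, ratDegree, natDegree_sub_eq_left_of_natDegree_lt hlt, hdeg.le]
    · rw [not_lt] at hdeg
      have hratDegree : ratDegree f = f.denom.natDegree := max_eq_right hdeg
      have hcoeff : (fibrePoly f v).coeff (ratDegree f) = f.num.coeff f.denom.natDegree - v := by
        rw [hratDegree, fibrePoly_coe, coeff_sub, coeff_C_mul, f.monic_denom.coeff_natDegree,
          mul_one]
      rw [OnePoint.coe_eq_coe, ← sub_eq_zero, ← hcoeff]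
      refine ⟨fun h0 => (natDegree_fibrePoly_le f v).lt_of_ne fun hd => ?_,
        coeff_eq_zero_of_natDegree_lt⟩
      rw [← hd, coeff_natDegree, leadingCoeff_eq_zero] at h0
      exact fibrePoly_ne_zero hf v h0

lemma natDegree_fibrePoly_of_ne (hf : 1 ≤ ratDegree f) (hv : sphereMap f ∞ ≠ v) :
    (fibrePoly f v).natDegree = ratDegree f :=
  (natDegree_fibrePoly_le f v).antisymm (not_lt.1 (mt (sphereMap_infty_eq_iff hf).2 hv))

lemma mult_coe (f : RatFunc ℂ) (a : ℂ) :
    mult f a = (fibrePoly f (sphereMap f a)).rootMultiplicity a := by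
  have key (v : OnePoint ℂ) (hv : sphereMap f a = v) :
      mult f a = (fibrePoly f v).rootMultiplicity a := by
    induction v using OnePoint.rec <;> (unfold mult; rw [hv]; rfl)
  exact key _ rfl

lemma mult_infty (hf : 1 ≤ ratDegree f) :
    mult f ∞ = ratDegree f - (fibrePoly f (sphereMap f ∞)).natDegree := by
  have key (v : OnePoint ℂ) (hv : sphereMap f ∞ = v) :
      mult f ∞ = ratDegree f - (fibrePoly f v).natDegree := by
    unfold mult
    rw [hv]
    induction v using OnePoint.rec with
    | infty =>
      have hnum : (fibrePoly f (0 : ℂ)).natDegree = ratDegree f :=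
        natDegree_fibrePoly_of_ne hf (by simp [hv])
      rw [← hnum, fibrePoly_zero, fibrePoly_infty]
    | coe v =>
      have hdenom : (fibrePoly f ∞).natDegree = ratDegree f :=
        natDegree_fibrePoly_of_ne hf (by simp [hv])
      rw [← hdenom, fibrePoly_infty, fibrePoly_coe]
  exact key _ rfl

lemma one_le_mult (hf : 1 ≤ ratDegree f) (p : OnePoint ℂ) : 1 ≤ mult f p := by
  induction p using OnePoint.rec with
  | infty =>
    rw [mult_infty hf]
    exact Nat.sub_pos_of_lt ((sphereMap_infty_eq_iff hf).1 rfl)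
  | coe a =>
    rw [mult_coe]
    exact (rootMultiplicity_pos (fibrePoly_ne_zero hf _)).2 (sphereMap_coe_eq_iff.1 rfl)

lemma ramOrd_add_one (hf : 1 ≤ ratDegree f) (p : OnePoint ℂ) : ramOrd f p + 1 = mult f p :=
  Nat.sub_add_cancel (one_le_mult hf p)

lemma wronskian_num_denom_ne_zero (hf : 1 ≤ ratDegree f) : wronskian f.num f.denom ≠ 0 := by
  rw [Ne, f.isCoprime_num_denom.wronskian_eq_zero_iff, derivative_eq_zero, derivative_eq_zero]
  rintro ⟨hnum, hdenom⟩
  simp [ratDegree, hnum, hdenom] at hf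

lemma exists_wronskian_fibrePoly (f : RatFunc ℂ) (v : OnePoint ℂ) :
    ∃ w ≠ v, wronskian (fibrePoly f v) (fibrePoly f w) = wronskian f.num f.denom ∨
      wronskian (fibrePoly f v) (fibrePoly f w) = -wronskian f.num f.denom := by
  induction v using OnePoint.rec with
  | infty =>
    refine ⟨(0 : ℂ), coe_ne_infty 0, Or.inr ?_⟩
    rw [fibrePoly_infty, fibrePoly_zero, wronskian_neg_eq]
  | coe v =>
    refine ⟨∞, infty_ne_coe v, Or.inl ?_⟩
    simp only [fibrePoly_infty, fibrePoly_coe, wronskian, derivative_sub, derivative_C_mul]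
    ring

theorem rootMultiplicity_wronskian_num_denom (hf : 1 ≤ ratDegree f) (a : ℂ) :
    (wronskian f.num f.denom).rootMultiplicity a = ramOrd f a := by
  obtain ⟨w, hw, hW⟩ := exists_wronskian_fibrePoly f (sphereMap f a)
  have hne : wronskian (fibrePoly f (sphereMap f a)) (fibrePoly f w) ≠ 0 := by
    rcases hW with hW | hW <;> simpa [hW] using wronskian_num_denom_ne_zero hf
  have hmult := rootMultiplicity_wronskian_add_one hne (sphereMap_coe_eq_iff.1 rfl)
    (mt sphereMap_coe_eq_iff.2 hw.symm)
  rw [ramOrd, mult_coe, ← hmult, Nat.add_sub_cancel]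
  rcases hW with hW | hW <;> simp [hW, rootMultiplicity_neg]

theorem natDegree_wronskian_num_denom (hf : 1 ≤ ratDegree f) :
    (wronskian f.num f.denom).natDegree + ramOrd f ∞ = 2 * ratDegree f - 2 := by
  obtain ⟨w, hw, hW⟩ := exists_wronskian_fibrePoly f (sphereMap f ∞)
  have hlt : (fibrePoly f (sphereMap f ∞)).natDegree < ratDegree f :=
    (sphereMap_infty_eq_iff hf).1 rfl
  have hdeg : (fibrePoly f w).natDegree = ratDegree f := natDegree_fibrePoly_of_ne hf hw.symm
  have hadd := natDegree_wronskian_add_one (fibrePoly_ne_zero hf _) (fibrePoly_ne_zero hf _)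
    (hdeg ▸ hlt.ne)
  have hnat : (wronskian (fibrePoly f (sphereMap f ∞)) (fibrePoly f w)).natDegree =
      (wronskian f.num f.denom).natDegree := by
    rcases hW with hW | hW <;> simp [hW]
  rw [ramOrd, mult_infty hf]
  omega

end Fibre

/-! ### The Riemann–Hurwitz formula on the sphere -/

section RiemannHurwitz

variable {f : RatFunc ℂ}

lemma finsum_onePoint {F : OnePoint ℂ → ℕ} (hF : (Function.support fun a : ℂ => F a).Finite) :
    ∑ᶠ p, F p = F ∞ + ∑ᶠ a : ℂ, F a := by
  rw [← finsum_mem_univ, ← insert_infty_range_coe, finsum_mem_insert' _ infty_notMem_range_coe,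
    finsum_mem_range coe_injective]
  refine (hF.image ((↑) : ℂ → OnePoint ℂ)).subset ?_
  rintro _ ⟨⟨a, rfl⟩, ha⟩
  exact ⟨a, ha, rfl⟩

lemma support_rootMultiplicity_finite (A : ℂ[X]) :
    (Function.support fun a => A.rootMultiplicity a).Finite :=
  A.roots.toFinset.finite_toSet.subset fun a ha => by
    rwa [Finset.mem_coe, Multiset.mem_toFinset, ← Multiset.count_ne_zero, count_roots]

lemma finsum_rootMultiplicity (A : ℂ[X]) : ∑ᶠ a, A.rootMultiplicity a = A.natDegree := by
  rw [(IsAlgClosed.splits A).natDegree_eq_card_roots, ← Multiset.toFinset_sum_count_eq]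
  simp only [count_roots]
  refine finsum_eq_sum_of_support_subset _ fun a ha => ?_
  rwa [Finset.mem_coe, Multiset.mem_toFinset, ← Multiset.count_ne_zero, count_roots]

lemma preimage_singleton_finite (hf : 1 ≤ ratDegree f) (v : OnePoint ℂ) :
    (sphereMap f ⁻¹' {v}).Finite := by
  refine (((support_rootMultiplicity_finite (fibrePoly f v)).image (↑)).insert ∞).subset ?_
  intro p hp
  induction p using OnePoint.rec with
  | infty => exact Set.mem_insert _ _
  | coe a =>
    refine Set.mem_insert_of_mem _ ⟨a, Nat.pos_iff_ne_zero.1 ?_, rfl⟩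
    exact (rootMultiplicity_pos (fibrePoly_ne_zero hf v)).2 (sphereMap_coe_eq_iff.1 hp)

open Classical in
theorem finsum_mult_fibre (hf : 1 ≤ ratDegree f) (v : OnePoint ℂ) :
    ∑ᶠ p, (if sphereMap f p = v then mult f p else 0) = ratDegree f := by
  have hcoe (a : ℂ) : (if sphereMap f a = v then mult f a else 0) =
      (fibrePoly f v).rootMultiplicity a := by
    split_ifs with hv
    · rw [mult_coe, hv]
    · exact (rootMultiplicity_eq_zero (mt sphereMap_coe_eq_iff.2 hv)).symm
  have hinfty : (if sphereMap f ∞ = v then mult f ∞ else 0) =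
      ratDegree f - (fibrePoly f v).natDegree := by
    split_ifs with hv
    · rw [mult_infty hf, hv]
    · rw [natDegree_fibrePoly_of_ne hf hv, Nat.sub_self]
  rw [finsum_onePoint (by simpa only [hcoe] using support_rootMultiplicity_finite _), hinfty]
  simp only [hcoe, finsum_rootMultiplicity]
  exact Nat.sub_add_cancel (natDegree_fibrePoly_le f v)

theorem finsum_ramOrd (hf : 1 ≤ ratDegree f) : ∑ᶠ p, ramOrd f p = 2 * ratDegree f - 2 := by
  rw [finsum_onePoint] <;> simp only [← rootMultiplicity_wronskian_num_denom hf]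
  · rw [finsum_rootMultiplicity, add_comm, natDegree_wronskian_num_denom hf]
  · exact support_rootMultiplicity_finite _

theorem finite_preimage (hf : 1 ≤ ratDegree f) (T : Finset (OnePoint ℂ)) :
    (sphereMap f ⁻¹' T).Finite :=
  T.finite_toSet.preimage' fun v _ => preimage_singleton_finite hf v

theorem ncard_preimage_add (hf : 1 ≤ ratDegree f) {T : Finset (OnePoint ℂ)}
    (hT : ∀ p, sphereMap f p ∉ T → ramOrd f p = 0) :
    (sphereMap f ⁻¹' T).ncard + (2 * ratDegree f - 2) = T.card * ratDegree f := by
  classical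
  set S := (finite_preimage hf T).toFinset
  have hS (p : OnePoint ℂ) : p ∈ S ↔ sphereMap f p ∈ T := by simp [S]
  have hram : ∑ p ∈ S, ramOrd f p = 2 * ratDegree f - 2 := by
    rw [← finsum_ramOrd hf]
    refine (finsum_eq_sum_of_support_subset _ fun p hp => ?_).symm
    exact (hS p).2 (not_imp_comm.1 (hT p) hp)
  have hfibre {v : OnePoint ℂ} (hv : v ∈ T) :
      ∑ p ∈ S with sphereMap f p = v, mult f p = ratDegree f := by
    rw [← finsum_mult_fibre hf v, Finset.sum_filter]
    refine (finsum_eq_sum_of_support_subset _ fun p hp => ?_).symm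
    obtain rfl : sphereMap f p = v := by_contra fun h => hp (if_neg h)
    exact (hS p).2 hv
  calc (sphereMap f ⁻¹' T).ncard + (2 * ratDegree f - 2)
      = ∑ p ∈ S, (1 + ramOrd f p) := by
        rw [Finset.sum_add_distrib, hram, Finset.sum_const, smul_eq_mul, mul_one,
          Set.ncard_eq_toFinset_card _ (finite_preimage hf T)]
    _ = ∑ p ∈ S, mult f p := by simp only [add_comm 1, ramOrd_add_one hf]
    _ = ∑ v ∈ T, ∑ p ∈ S with sphereMap f p = v, mult f p :=
        (Finset.sum_fiberwise_of_maps_to (fun p hp => (hS p).1 hp) _).symm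
    _ = T.card * ratDegree f := by
        rw [Finset.sum_congr rfl fun v hv => hfibre hv, Finset.sum_const, smul_eq_mul]

open Classical in
lemma coe_finset_threePoints :
    (({((0 : ℂ) : OnePoint ℂ), ((1 : ℂ) : OnePoint ℂ), ∞} : Finset (OnePoint ℂ)) :
      Set (OnePoint ℂ)) = threePoints := by
  simp [threePoints]

theorem marked_finite (hf : 1 ≤ ratDegree f) : (marked f).Finite := by
  classical
  rw [marked, ← coe_finset_threePoints]
  exact finite_preimage hf _

theorem ncard_marked (hf : IsBelyi f) : (marked f).ncard = ratDegree f + 2 := by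
  classical
  have hcard := ncard_preimage_add hf.1
    (T := {((0 : ℂ) : OnePoint ℂ), ((1 : ℂ) : OnePoint ℂ), ∞})
    fun p hp => hf.2 p (by rwa [← coe_finset_threePoints])
  rw [coe_finset_threePoints, Finset.card_eq_three.2 ⟨_, _, _, by simp, coe_ne_infty 0,
    coe_ne_infty 1, rfl⟩] at hcard
  have hdeg := hf.1
  rw [marked]
  omega

end RiemannHurwitz

/-! ### Local coordinates on the sphere -/

section Coordinates

variable {f : RatFunc ℂ} {A : ℂ[X]} {v : ℂ} {p w : OnePoint ℂ}

/-- The inverse of the local coordinate at the point `p` of the sphere: `x = 1 / t` if `p = ∞`, and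
`x = t` otherwise. -/
def coord (p : OnePoint ℂ) (t : ℂ) : ℂ := p.elim t⁻¹ fun _ => t

/-- The value at `p` of the local coordinate described by `coord p`. -/
def center (p : OnePoint ℂ) : ℂ := p.elim 0 id

/-- The order at the point `p` of the sphere of the rational function defined by a polynomial. -/
def ordAt (A : ℂ[X]) (p : OnePoint ℂ) : ℤ := p.elim (-A.natDegree) fun a => A.rootMultiplicity a

/-- The rational function `f` in the local coordinate at `p`. -/
def chart (f : RatFunc ℂ) (p : OnePoint ℂ) (t : ℂ) : ℂ := ratFun f (coord p t)

lemma exists_eval_coord (hA : A ≠ 0) (p : OnePoint ℂ) :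
    ∃ g : ℂ → ℂ, AnalyticAt ℂ g (center p) ∧ g (center p) ≠ 0 ∧ ∀ᶠ t in 𝓝[≠] center p,
      A.eval (coord p t) = (t - center p) ^ ordAt A p * g t := by
  induction p using OnePoint.rec with
  | infty =>
    refine ⟨fun t => A.reverse.eval t, A.reverse.differentiable.analyticAt _, ?_, ?_⟩
    · simpa [center, ← coeff_zero_eq_eval_zero] using hA
    · filter_upwards [self_mem_nhdsWithin] with t ht
      have ht0 : t ≠ 0 := ht
      let _ : Invertible t⁻¹ := invertibleOfNonzero (inv_ne_zero ht0)
      have hrev := eval₂_reverse_mul_pow (RingHom.id ℂ) t⁻¹ A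
      rw [invOf_eq_inv, inv_inv, eval₂_id, eval₂_id] at hrev
      simp only [coord, center, ordAt, elim_infty, sub_zero, zpow_neg, zpow_natCast]
      rw [← hrev, inv_pow, mul_comm]
  | coe a =>
    obtain ⟨B, hB, hdvd⟩ := exists_eq_pow_rootMultiplicity_mul_and_not_dvd A hA a
    refine ⟨fun t => B.eval t, B.differentiable.analyticAt _, mt dvd_iff_isRoot.2 hdvd,
      .of_forall fun t => ?_⟩
    simp only [coord, center, ordAt, elim_some, id_eq, zpow_natCast]
    nth_rw 1 [hB]
    simp

lemma eventually_eval_coord_ne_zero (hA : A ≠ 0) (p : OnePoint ℂ) :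
    ∀ᶠ t in 𝓝[≠] center p, A.eval (coord p t) ≠ 0 := by
  obtain ⟨g, hg, hg0, hgA⟩ := exists_eval_coord hA p
  filter_upwards [hgA, self_mem_nhdsWithin,
    nhdsWithin_le_nhds (hg.continuousAt.eventually_ne hg0)] with t ht htp hgt
  rw [ht]
  exact mul_ne_zero (zpow_ne_zero _ (sub_ne_zero.2 htp)) hgt

lemma ordAt_fibrePoly_sub (hf : 1 ≤ ratDegree f) (hw : sphereMap f p ≠ w) :
    ordAt (fibrePoly f (sphereMap f p)) p - ordAt (fibrePoly f w) p = mult f p := by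
  induction p using OnePoint.rec with
  | infty =>
    have hle := natDegree_fibrePoly_le f (sphereMap f ∞)
    simp only [ordAt, elim_infty, natDegree_fibrePoly_of_ne hf hw, mult_infty hf]
    omega
  | coe a =>
    simp only [ordAt, elim_some, rootMultiplicity_eq_zero (mt sphereMap_coe_eq_iff.2 hw), mult_coe,
      Nat.cast_zero, sub_zero]

lemma exists_fibrePoly_div_eq (hf : 1 ≤ ratDegree f) (hw : sphereMap f p ≠ w) :
    ∃ g : ℂ → ℂ, AnalyticAt ℂ g (center p) ∧ g (center p) ≠ 0 ∧ ∀ᶠ t in 𝓝[≠] center p,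
      (fibrePoly f (sphereMap f p)).eval (coord p t) / (fibrePoly f w).eval (coord p t) =
        (t - center p) ^ mult f p * g t := by
  obtain ⟨g, hg, hg0, hgA⟩ := exists_eval_coord (fibrePoly_ne_zero hf (sphereMap f p)) p
  obtain ⟨k, hk, hk0, hkA⟩ := exists_eval_coord (fibrePoly_ne_zero hf w) p
  refine ⟨fun t => g t / k t, hg.fun_div hk hk0, div_ne_zero hg0 hk0, ?_⟩
  filter_upwards [hgA, hkA, self_mem_nhdsWithin] with t ht ht' htp
  rw [ht, ht', mul_div_mul_comm, ← zpow_sub₀ (sub_ne_zero.2 htp), ordAt_fibrePoly_sub hf hw,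
    zpow_natCast]

lemma ratFun_eq (f : RatFunc ℂ) (x : ℂ) : ratFun f x = f.num.eval x / f.denom.eval x := by
  rw [ratFun, RatFunc.eval, eval₂_id, eval₂_id]

lemma exists_chart_sub_eq (hf : 1 ≤ ratDegree f) (hv : sphereMap f p = v) :
    ∃ g : ℂ → ℂ, AnalyticAt ℂ g (center p) ∧ g (center p) ≠ 0 ∧ ∀ᶠ t in 𝓝[≠] center p,
      chart f p t - v = (t - center p) ^ mult f p * g t := by
  obtain ⟨g, hg, hg0, hgf⟩ := exists_fibrePoly_div_eq (w := ∞) hf (hv ▸ coe_ne_infty v)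
  refine ⟨g, hg, hg0, ?_⟩
  filter_upwards [hgf, eventually_eval_coord_ne_zero f.denom_ne_zero p] with t ht hden
  rw [← ht, hv, chart, ratFun_eq, fibrePoly_coe, fibrePoly_infty, eval_sub, eval_C_mul, sub_div,
    mul_div_cancel_right₀ v hden]

lemma exists_chart_eq_inv (hf : 1 ≤ ratDegree f) (hp : sphereMap f p = ∞) :
    ∃ g : ℂ → ℂ, AnalyticAt ℂ g (center p) ∧ g (center p) ≠ 0 ∧ ∀ᶠ t in 𝓝[≠] center p,
      chart f p t = ((t - center p) ^ mult f p)⁻¹ * g t := by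
  obtain ⟨g, hg, hg0, hgf⟩ := exists_fibrePoly_div_eq (w := (0 : ℂ)) hf (hp ▸ infty_ne_coe 0)
  refine ⟨fun t => (g t)⁻¹, hg.fun_inv hg0, inv_ne_zero hg0, ?_⟩
  filter_upwards [hgf] with t ht
  rw [chart, ratFun_eq, ← mul_inv, ← ht, hp, fibrePoly_zero, fibrePoly_infty, inv_div]

lemma isBigO_cobounded_iff {F G : ℂ → ℂ} : F =O[Bornology.cobounded ℂ] G ↔
    (fun t => F t⁻¹) =O[𝓝[≠] 0] fun t => G t⁻¹ := by
  have hmap : Bornology.cobounded ℂ = map (fun t : ℂ => t⁻¹) (𝓝[≠] 0) := inv_nhdsNE_zero.symm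
  rw [hmap, isBigO_map]
  rfl

lemma hasCoeffs_iff_of_coe (hf : 1 ≤ ratDegree f) (hv : sphereMap f p = v) {c d : ℂ} :
    HasCoeffs f p c d ↔ c ≠ 0 ∧
      (fun t => chart f p t - v - c * (t - center p) ^ (mult f p : ℤ) *
        (1 + d / c * (t - center p))) =O[𝓝[≠] center p]
          fun t => (t - center p) ^ ((mult f p : ℤ) + 2) := by
  unfold HasCoeffs
  rw [hv, ← Nat.cast_succ, Nat.succ_eq_add_one, ramOrd_add_one hf]
  refine and_congr_right fun _ => ?_
  induction p using OnePoint.rec with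
  | infty =>
    refine isBigO_cobounded_iff.trans ?_
    simp only [chart, coord, center, elim_infty, sub_zero, inv_inv, inv_zpow', neg_sub, neg_neg,
      sub_neg_eq_add, add_comm (2 : ℤ)]
  | coe a => rfl

lemma hasCoeffs_iff_of_infty (hf : 1 ≤ ratDegree f) (hp : sphereMap f p = ∞) {c d : ℂ} :
    HasCoeffs f p c d ↔ c ≠ 0 ∧
      (fun t => chart f p t - c * (t - center p) ^ (-(mult f p : ℤ)) *
        (1 + d / c * (t - center p))) =O[𝓝[≠] center p]
          fun t => (t - center p) ^ (-(mult f p : ℤ) + 2) := by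
  unfold HasCoeffs
  rw [hp, ← Nat.cast_succ, Nat.succ_eq_add_one, ramOrd_add_one hf]
  refine and_congr_right fun _ => ?_
  induction p using OnePoint.rec with
  | infty =>
    refine isBigO_cobounded_iff.trans ?_
    simp only [chart, coord, center, elim_infty, sub_zero, inv_inv, inv_zpow', neg_sub,
      neg_add_eq_sub]
  | coe a => rfl

end Coordinates

/-! ### The pullback metric near the marked points -/

section Pullback

variable {f : RatFunc ℂ} {p : OnePoint ℂ} {x : ℂ}

lemma coe_notMem_marked_iff : (x : OnePoint ℂ) ∉ marked f ↔
    (fibrePoly f (0 : ℂ)).eval x ≠ 0 ∧ (fibrePoly f (1 : ℂ)).eval x ≠ 0 ∧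
      (fibrePoly f ∞).eval x ≠ 0 := by
  simp only [marked, threePoints, Set.mem_preimage, Set.mem_insert_iff, Set.mem_singleton_iff,
    sphereMap_coe_eq_iff, IsRoot, not_or]

lemma eventually_coord_notMem_marked (hf : 1 ≤ ratDegree f) (p : OnePoint ℂ) :
    ∀ᶠ t in 𝓝[≠] center p, (coord p t : OnePoint ℂ) ∉ marked f := by
  simp only [coe_notMem_marked_iff, eventually_and]
  exact ⟨eventually_eval_coord_ne_zero (fibrePoly_ne_zero hf _) p,
    eventually_eval_coord_ne_zero (fibrePoly_ne_zero hf _) p,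
    eventually_eval_coord_ne_zero (fibrePoly_ne_zero hf _) p⟩

lemma eventually_cobounded_notMem_marked (hf : 1 ≤ ratDegree f) :
    ∀ᶠ x : ℂ in Bornology.cobounded ℂ, (x : OnePoint ℂ) ∉ marked f :=
  Bornology.isBounded_def.1 ((marked_finite hf).preimage coe_injective.injOn).isBounded

lemma ratFun_mem_compl (hx : (x : OnePoint ℂ) ∉ marked f) : ratFun f x ∈ ({0, 1}ᶜ : Set ℂ) := by
  obtain ⟨h0, h1, hinf⟩ := coe_notMem_marked_iff.1 hx
  rw [fibrePoly_zero] at h0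
  rw [fibrePoly_infty] at hinf
  rw [fibrePoly_coe, map_one, one_mul, eval_sub, sub_ne_zero] at h1
  simpa [ratFun_eq, div_eq_one_iff_eq hinf, hinf] using ⟨h0, h1⟩

lemma analyticAt_ratFun (hx : (x : OnePoint ℂ) ∉ marked f) : AnalyticAt ℂ (ratFun f) x := by
  rw [funext (ratFun_eq f)]
  exact (f.num.differentiable.analyticAt x).fun_div (f.denom.differentiable.analyticAt x)
    (coe_notMem_marked_iff.1 hx).2.2

lemma deriv_ratFun_ne_zero (hf : IsBelyi f) (hx : (x : OnePoint ℂ) ∉ marked f) :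
    deriv (ratFun f) x ≠ 0 := by
  have hden : f.denom.eval x ≠ 0 := (coe_notMem_marked_iff.1 hx).2.2
  have hW : (wronskian f.num f.denom).eval x ≠ 0 := by
    rw [Ne, ← IsRoot.def, ← rootMultiplicity_pos (wronskian_num_denom_ne_zero hf.1),
      rootMultiplicity_wronskian_num_denom hf.1, hf.2 x hx]
    exact lt_irrefl 0
  rw [funext (ratFun_eq f), ((f.num.hasDerivAt x).fun_div (f.denom.hasDerivAt x) hden).deriv]
  refine div_ne_zero ?_ (pow_ne_zero 2 hden)
  rw [wronskian, eval_sub, eval_mul, eval_mul] at hW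
  rwa [← neg_ne_zero, neg_sub]

lemma eventually_chart_regular (hf : IsBelyi f) (p : OnePoint ℂ) :
    ∀ᶠ t in 𝓝[≠] center p, AnalyticAt ℂ (chart f p) t ∧ deriv (chart f p) t ≠ 0 := by
  filter_upwards [eventually_coord_notMem_marked hf.1 p, self_mem_nhdsWithin] with t ht htp
  induction p using OnePoint.rec with
  | infty =>
    have ht0 : t ≠ 0 := htp
    have hcomp : HasDerivAt (chart f ∞) (deriv (ratFun f) t⁻¹ * -(t ^ 2)⁻¹) t :=
      (analyticAt_ratFun ht).differentiableAt.hasDerivAt.comp t (hasDerivAt_inv ht0)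
    refine ⟨(analyticAt_ratFun ht).comp (analyticAt_inv ht0), ?_⟩
    rw [hcomp.deriv]
    exact mul_ne_zero (deriv_ratFun_ne_zero hf ht) (neg_ne_zero.2 (inv_ne_zero (pow_ne_zero 2 ht0)))
  | coe a => exact ⟨analyticAt_ratFun ht, deriv_ratFun_ne_zero hf ht⟩

lemma pullWeight_eq (hf : 1 ≤ ratDegree f) (β : TriDivisor) (p : OnePoint ℂ) :
    (pullWeight f β p : ℂ) =
      (mult f p : ℂ) ^ 2 * β.weight (sphereMap f p) + 1 - (mult f p : ℂ) ^ 2 := by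
  rw [← ramOrd_add_one hf p]
  simp only [pullWeight, pullOrder, TriDivisor.weight]
  push_cast
  ring

open Classical in
/-- The accessory parameter at `p` of the pullback metric, as a function of the first two
coefficients `c`, `d` of `f` at `p`. At a pole it is the one of `1 / f`, which vanishes at `p` and
has the coefficients `c⁻¹`, `-d / c ^ 2`. -/
def accessory (f : RatFunc ℂ) (β : TriDivisor) (p : OnePoint ℂ) (c d : ℂ) : ℂ :=
  if sphereMap f p = ∞ then
    pullAccessory (mult f p) c⁻¹ (-d / c ^ 2) (β.weight ∞) (β.schwarzParam ∞)
  else pullAccessory (mult f p) c d (β.weight (sphereMap f p)) (β.schwarzParam (sphereMap f p))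

theorem exists_hasCoeffs_iff_and_hasDoublePole (hf : IsBelyi f) (β : TriDivisor)
    (p : OnePoint ℂ) : ∃ c d : ℂ,
      (∀ c' d', HasCoeffs f p c' d' ↔ c' = c ∧ d' = d) ∧
      HasDoublePole (pullTensor β.tensor (chart f p)) (center p) (pullWeight f β p)
        (accessory f β p c d) := by
  have hmult : mult f p ≠ 0 := Nat.one_le_iff_ne_zero.1 (one_le_mult hf.1 p)
  rw [pullWeight_eq hf.1]
  induction hp : sphereMap f p using OnePoint.rec with
  | infty =>
    obtain ⟨g, hg, hg0, hgf⟩ := exists_chart_eq_inv hf.1 hp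
    refine ⟨g (center p), deriv g (center p), fun c d => ?_, ?_⟩
    · exact (hasCoeffs_iff_of_infty hf.1 hp).trans
        (isBigO_sub_zpow_mul_taylor_iff hg hg0 (by simpa only [zpow_neg, zpow_natCast] using hgf))
    · rw [accessory, if_pos hp]
      exact β.hasDoublePole_tensor_inv.pullTensor_inv hmult hg hg0 hgf
        (eventually_chart_regular hf p)
  | coe v =>
    obtain ⟨g, hg, hg0, hgf⟩ := exists_chart_sub_eq hf.1 hp
    refine ⟨g (center p), deriv g (center p), fun c d => ?_, ?_⟩
    · exact (hasCoeffs_iff_of_coe hf.1 hp).trans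
        (isBigO_sub_zpow_mul_taylor_iff hg hg0 (by simpa only [zpow_natCast] using hgf))
    · rw [accessory, hp, if_neg (coe_ne_infty v)]
      exact (β.hasDoublePole_tensor v).pullTensor_of_sub hmult hg hg0 hgf

end Pullback

section PullPotential

variable {f : RatFunc ℂ} {β : TriDivisor} {K : ℝ} {φ : ℂ → ℝ} {x : ℂ}

lemma IsConicalPotential.stressEnergy_pullPotential (hφ : IsConicalPotential β K φ)
    (h0 : -1 < β.b0) (h1 : -1 < β.b1) (hinf : -1 < β.binf) (hf : IsBelyi f)
    (hx : (x : OnePoint ℂ) ∉ marked f) :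
    stressEnergy (pullPotential f φ) x = pullTensor β.tensor (ratFun f) x := by
  have hmem := ratFun_mem_compl hx
  rw [pullTensor, ← hφ.stressEnergy_eqOn_tensor h0 h1 hinf hmem]
  exact stressEnergy_pull ((hφ.contDiffAt hmem).of_le (by norm_num)) (analyticAt_ratFun hx)
    (deriv_ratFun_ne_zero hf hx)

lemma differentiableAt_pullTensor (β : TriDivisor) (hf : IsBelyi f)
    (hx : (x : OnePoint ℂ) ∉ marked f) :
    DifferentiableAt ℂ (pullTensor β.tensor (ratFun f)) x := by
  have hfx := analyticAt_ratFun hx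
  have hτ := β.analyticAt_tensor (ratFun_mem_compl hx)
  have hL := analyticAt_logDeriv hfx.deriv (deriv_ratFun_ne_zero hf hx)
  exact ((hτ.differentiableAt.comp x hfx.differentiableAt).mul
    (hfx.deriv.differentiableAt.pow 2)).add
      (hL.deriv.differentiableAt.sub ((hL.differentiableAt.pow 2).div_const 2))

lemma isBigO_cobounded_of_hasDoublePole_chart_infty {τ : ℂ → ℂ} {s h : ℂ} (hf : IsBelyi f)
    (hpole : HasDoublePole (pullTensor τ (chart f ∞)) (center ∞) s h) :
    (fun x => pullTensor τ (ratFun f) x - (s / (2 * x ^ 2) + h / x ^ 3))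
      =O[Bornology.cobounded ℂ] fun x => x ^ (-4 : ℤ) := by
  rw [isBigO_cobounded_iff]
  refine (IsBigO.mul hpole (isBigO_refl (fun t : ℂ => t ^ 4) (𝓝[≠] 0))).congr' ?_ ?_
  · filter_upwards [eventually_coord_notMem_marked hf.1 ∞, self_mem_nhdsWithin] with t ht htp
    have ht0 : t ≠ 0 := htp
    have hchart : pullTensor τ (chart f ∞) t = pullTensor τ (ratFun f) t⁻¹ * (t ^ 4)⁻¹ :=
      pullTensor_comp_inv ht0 (analyticAt_ratFun ht) (deriv_ratFun_ne_zero hf ht)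
    rw [hchart]
    simp only [center, elim_infty, sub_zero]
    field_simp
  · refine .of_forall fun t => ?_
    simp only [inv_zpow', neg_neg, one_mul]
    norm_cast

lemma tendsto_zero_of_isBigO_cobounded {T : ℂ → ℂ} {s h : ℂ}
    (hT : (fun x => T x - (s / (2 * x ^ 2) + h / x ^ 3))
      =O[Bornology.cobounded ℂ] fun x => x ^ (-4 : ℤ)) :
    Tendsto T (Bornology.cobounded ℂ) (𝓝 0) := by
  have hpow {n : ℕ} (hn : n ≠ 0) :
      Tendsto (fun x : ℂ => (x ^ n)⁻¹) (Bornology.cobounded ℂ) (𝓝 0) := by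
    simpa only [inv_pow, zero_pow hn] using (tendsto_inv₀_cobounded (α := ℂ)).pow n
  have herror := hT.trans_tendsto (by exact_mod_cast hpow (n := 4) (by norm_num))
  have hmain := ((hpow two_ne_zero).const_mul (s / 2)).add ((hpow three_ne_zero).const_mul h)
  have hsum := herror.add hmain
  simp only [mul_zero, add_zero] at hsum
  refine hsum.congr fun x => ?_
  simp only [div_eq_mul_inv, mul_inv]
  ring

end PullPotential

section Accessory

variable {f : RatFunc ℂ} {p : OnePoint ℂ}

lemma accessory_of_ne_infty_of_ramOrd_eq_zero (hf : 1 ≤ ratDegree f) (β : TriDivisor)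
    (hp : sphereMap f p ≠ ∞) (hr : ramOrd f p = 0) (c d : ℂ) :
    accessory f β p c d =
      d / c * β.weight (sphereMap f p) + c * β.schwarzParam (sphereMap f p) := by
  rw [accessory, if_neg hp, ← ramOrd_add_one hf, hr, pullAccessory_one]

lemma accessory_of_eq_infty_of_ramOrd_eq_zero (hf : 1 ≤ ratDegree f) (β : TriDivisor)
    (hp : sphereMap f p = ∞) (hr : ramOrd f p = 0) (c d : ℂ) :
    accessory f β p c d = -(d / c) * β.weight ∞ + 1 / c * β.schwarzParam ∞ := by
  rw [accessory, if_pos hp, ← ramOrd_add_one hf, hr, pullAccessory_one]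
  rcases eq_or_ne c 0 with rfl | hc
  · simp
  · field_simp

lemma mult_sq_mul_weight_eq (hf : 1 ≤ ratDegree f) (β : TriDivisor) (p : OnePoint ℂ) :
    ((mult f p : ℂ) ^ 2 * β.weight (sphereMap f p) + 1 - (mult f p : ℂ) ^ 2) / mult f p =
      -(((pullOrder f β p * (pullOrder f β p + 2) : ℝ) : ℂ) / ((ramOrd f p : ℂ) + 1)) := by
  rw [← pullWeight_eq hf, pullWeight, ← ramOrd_add_one hf p]
  push_cast
  ring

lemma accessory_of_ne_infty_of_ramOrd_pos (hf : 1 ≤ ratDegree f) (β : TriDivisor)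
    (hp : sphereMap f p ≠ ∞) (hr : 0 < ramOrd f p) (c d : ℂ) :
    accessory f β p c d = -(d / c) *
      (((pullOrder f β p * (pullOrder f β p + 2) : ℝ) : ℂ) / ((ramOrd f p : ℂ) + 1)) := by
  have hmult : mult f p ≠ 1 := by have := ramOrd_add_one hf p; omega
  rw [accessory, if_neg hp, pullAccessory_of_ne_one hmult, mult_sq_mul_weight_eq hf]
  ring

lemma accessory_of_eq_infty_of_ramOrd_pos (hf : 1 ≤ ratDegree f) (β : TriDivisor)
    (hp : sphereMap f p = ∞) (hr : 0 < ramOrd f p) (c d : ℂ) :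
    accessory f β p c d = d / c *
      (((pullOrder f β p * (pullOrder f β p + 2) : ℝ) : ℂ) / ((ramOrd f p : ℂ) + 1)) := by
  have hmult : mult f p ≠ 1 := by have := ramOrd_add_one hf p; omega
  rw [accessory, if_pos hp, pullAccessory_of_ne_one hmult, ← hp, mult_sq_mul_weight_eq hf]
  rcases eq_or_ne c 0 with rfl | hc
  · simp
  · field_simp

end Accessory

end ConicalSphere

end

theorem mainTheorem4_general (β : TriDivisor) (hb0 : -1 < β.b0) (hb1 : -1 < β.b1)
    (hbinf : -1 < β.binf) (K : ℝ) (φ : ℂ → ℝ) (hφ : IsConicalPotential β K φ)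
    (f : RatFunc ℂ) (hf : IsBelyi f) :
    (marked f).Finite ∧ (marked f).ncard = ratDegree f + 2 ∧
    ∃ h : OnePoint ℂ → ℂ,
      (∀ x : ℂ, (x : OnePoint ℂ) ∉ marked f →
        stressEnergy (pullPotential f φ) x =
          ∑ᶠ a ∈ {a : ℂ | (a : OnePoint ℂ) ∈ marked f},
            ((pullWeight f β (a : OnePoint ℂ) : ℂ) / (2 * (x - a) ^ 2)
              + h (a : OnePoint ℂ) / (x - a))) ∧
      ((fun x : ℂ => stressEnergy (pullPotential f φ) x
          - ((pullWeight f β ∞ : ℂ) / (2 * x ^ 2) + h ∞ / x ^ 3))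
        =O[Bornology.cobounded ℂ] fun x : ℂ => x ^ (-4 : ℤ)) ∧
      ∀ p : OnePoint ℂ,
        (∃ c d : ℂ, HasCoeffs f p c d) ∧
        ∀ c d : ℂ, HasCoeffs f p c d →
          (sphereMap f p ≠ ∞ → ramOrd f p = 0 →
            h p = d / c * (β.weight (sphereMap f p) : ℂ)
              + c * (β.schwarzParam (sphereMap f p) : ℂ)) ∧
          (sphereMap f p ≠ ∞ → 0 < ramOrd f p →
            h p = -(d / c) * (((pullOrder f β p * (pullOrder f β p + 2) : ℝ) : ℂ)
              / ((ramOrd f p : ℂ) + 1))) ∧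
          (sphereMap f p = ∞ → ramOrd f p = 0 →
            h p = -(d / c) * (β.weight ∞ : ℂ) + 1 / c * (β.schwarzParam ∞ : ℂ)) ∧
          (sphereMap f p = ∞ → 0 < ramOrd f p →
            h p = d / c * (((pullOrder f β p * (pullOrder f β p + 2) : ℝ) : ℂ)
              / ((ramOrd f p : ℂ) + 1))) := by
  choose c d hcoeffs hpole using exists_hasCoeffs_iff_and_hasDoublePole hf β
  have hO := isBigO_cobounded_of_hasDoublePole_chart_infty hf (hpole ∞)
  have hT {x : ℂ} := hφ.stressEnergy_pullPotential (x := x) hb0 hb1 hbinf hf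
  have hS : {a : ℂ | (a : OnePoint ℂ) ∈ marked f}.Finite :=
    (marked_finite hf.1).preimage coe_injective.injOn
  refine ⟨marked_finite hf.1, ncard_marked hf, fun p => accessory f β p (c p) (d p),
    fun x hx => ?_, hO.congr' ?_ .rfl,
    fun p => ⟨⟨c p, d p, (hcoeffs p _ _).2 ⟨rfl, rfl⟩⟩, fun c' d' hcd => ?_⟩⟩
  · rw [hT hx, finsum_mem_eq_finite_toFinset_sum _ hS]
    exact eq_sum_of_hasDoublePole (s := fun a => pullWeight f β a)
      (fun z hz => (differentiableAt_pullTensor β hf (by simpa using hz)).differentiableWithinAt)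
      (fun a _ => hpole a) (tendsto_zero_of_isBigO_cobounded hO) (by simpa using hx)
  · filter_upwards [eventually_cobounded_notMem_marked hf.1] with x hx
    rw [hT hx]
  · obtain ⟨rfl, rfl⟩ := (hcoeffs p c' d').1 hcd
    exact ⟨fun hp hr => accessory_of_ne_infty_of_ramOrd_eq_zero hf.1 β hp hr _ _,
      fun hp hr => accessory_of_ne_infty_of_ramOrd_pos hf.1 β hp hr _ _,
      fun hp hr => accessory_of_eq_infty_of_ramOrd_eq_zero hf.1 β hp hr _ _,
      fun hp hr => accessory_of_eq_infty_of_ramOrd_pos hf.1 β hp hr _ _⟩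

theorem mainTheorem4 (β : TriDivisor)
    (hb0 : -1 < β.b0 ∧ β.b0 ≤ 0) (hb1 : -1 < β.b1 ∧ β.b1 ≤ 0)
    (hbinf : -1 < β.binf ∧ β.binf ≤ 0)
    (φ : ℂ → ℝ) (hφ : IsTriPotential β φ)
    (f : RatFunc ℂ) (hf : IsBelyi f) (hfinf : sphereMap f ∞ ∈ threePoints) :
    -- there are exactly `deg f + 2` marked points
    (marked f).Finite ∧ (marked f).ncard = ratDegree f + 2 ∧
    ∃ h : OnePoint ℂ → ℂ,
      -- the stress-energy tensor off the marked points
      (∀ x : ℂ, (x : OnePoint ℂ) ∉ marked f →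
        stressEnergy (pullPotential f φ) x =
          ∑ᶠ a ∈ {a : ℂ | (a : OnePoint ℂ) ∈ marked f},
            ((pullWeight f β (a : OnePoint ℂ) : ℂ) / (2 * (x - a) ^ 2)
              + h (a : OnePoint ℂ) / (x - a))) ∧
      -- the stress-energy tensor at infinity
      ((fun x : ℂ => stressEnergy (pullPotential f φ) x
          - ((pullWeight f β ∞ : ℂ) / (2 * x ^ 2) + h ∞ / x ^ 3))
        =O[Bornology.cobounded ℂ] fun x : ℂ => x ^ (-4 : ℤ)) ∧
      -- the accessory parameters
      ∀ p ∈ marked f,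
        (∃ c d : ℂ, HasCoeffs f p c d) ∧
        ∀ c d : ℂ, HasCoeffs f p c d →
          (sphereMap f p ≠ ∞ → ramOrd f p = 0 →
            h p = d / c * (β.weight (sphereMap f p) : ℂ)
              + c * (β.schwarzParam (sphereMap f p) : ℂ)) ∧
          (sphereMap f p ≠ ∞ → 0 < ramOrd f p →
            h p = -(d / c) * (((pullOrder f β p * (pullOrder f β p + 2) : ℝ) : ℂ)
              / ((ramOrd f p : ℂ) + 1))) ∧
          (sphereMap f p = ∞ → ramOrd f p = 0 →
            h p = -(d / c) * (β.weight ∞ : ℂ) + 1 / c * (β.schwarzParam ∞ : ℂ)) ∧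
          (sphereMap f p = ∞ → 0 < ramOrd f p →
            h p = d / c * (((pullOrder f β p * (pullOrder f β p + 2) : ℝ) : ℂ)
              / ((ramOrd f p : ℂ) + 1))) := by
  obtain ⟨hfin, hcard, h, hT, hinf, hacc⟩ :=
    mainTheorem4_general β hb0.1 hb1.1 hbinf.1 _ φ hφ.isConicalPotential f hf
  exact ⟨hfin, hcard, h, hT, hinf, fun p _ => hacc p⟩
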